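/- For $m\in\mathbb N=\{0,1,2,\dots\}$ let $P_m$ be the complex vector space of homogeneous polynomials of degree $m$ in $x_1,x_2$, with the inner product $\langle x_1^{l}x_2^{m-l},x_1^{k}x_2^{m-k}\rangle=l!\,(m-l)!\,\delta_{lk}$, and let $\rho_m$ be the representation of $SU(2)$ on $P_m$ given by $(\rho_m(g)f)(x_1,x_2)=f((x_1,x_2)g)$. Identify $P_m\otimes P_n$ with the space of polynomials in $x=(x_1,x_2)$, $y=(y_1,y_2)$ that are homogeneous of degree $m$ in $x$ and of degree $n$ in $y$, via $f\otimes g\mapsto f(x)g(y)$. Let $\Delta_{yx}=y_1\frac{\partial}{\partial x_1}+y_2\frac{\partial}{\partial x_2}$, and let $\Gamma_{xy}$ be multiplication by $x_1y_2-y_1x_2$. For $0\le h\le\min\{m,n\}$ define $c_{m,n,h}$ by $c_{m,0,0}=1$ and, for $n\ge1$, $c_{m,n,h}=\frac{1}{(m+1)n}\left(c_{m-1,n-1,h-1}+c_{m+1,n-1,h}\right)$, where the first summand is omitted if $h=0$ and the second is omitted if $h=n$. With $r=m+n-2h$ let $$\alpha_{m,n,h}:P_r\to P_m\otimes P_n,\qquad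 \alpha_{m,n,h}(f)=\sqrt{c_{m,n,h}}\;\Gamma_{xy}^{h}\,\Delta_{yx}^{n-h}f(x),$$ $$\Phi_{m,n,h}:\mathrm{End}(P_r)\to\mathrm{End}(P_m),\qquad \Phi_{m,n,h}(A)=\mathrm{Tr}_{P_n}\!\left(\alpha_{m,n,h}\,A\,\alpha_{m,n,h}^{*}\right),$$ where $\mathrm{Tr}_{P_n}$ is the partial trace over $P_n$. For $r,m\in\mathbb N$ let $EC(r,m)$ be the set of all $\Phi_{m,n,h}$ with $n,h\in\mathbb N$, $0\le h\le\min\{m,n\}$ and $m+n-2h=r$ (the EPOSIC channels from $\mathrm{End}(P_r)$ to $\mathrm{End}(P_m)$). A linear map $\Phi:\mathrm{End}(P_r)\to\mathrm{End}(P_m)$ is called $SU(2)$-equivariant if $\Phi(\rho_r(g)A\rho_r(g)^{-1})=\rho_m(g)\Phi(A)\rho_m(g)^{-1}$ for all $g\in SU(2)$ and $A\in\mathrm{End}(P_r)$. It is a quantum channel if it is completely positive and trace preserving. An $SU(2)$-irreducibly covariant channel is an $SU(2)$-equivariant quantum channel for which the two representations $\rho_r,\rho_m$ are irreducible. Then for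 all $r,m\in\mathbb N$: 1. the set of all $SU(2)$-irreducibly covariant channels $\mathrm{End}(P_r)\to\mathrm{End}(P_m)$ is the convex hull of $EC(r,m)$; 2. the complex linear span of $EC(r,m)$ is the space of all $SU(2)$-equivariant linear maps $\mathrm{End}(P_r)\to\mathrm{End}(P_m)$. -/

import Mathlib

open scoped TensorProduct ComplexOrder CStarAlgebra

noncomputable section

namespace SU2Channel

/-! ### Quantum channels and covariance -/

/-- A linear map `End(H) → End(K)` is completely positive if it is so as a map between the
C⋆-algebras of (automatically bounded) operators on `H` and `K`. -/
def IsCompletelyPositive {H K : Type*}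
    [NormedAddCommGroup H] [InnerProductSpace ℂ H] [FiniteDimensional ℂ H] [CompleteSpace H]
    [NormedAddCommGroup K] [InnerProductSpace ℂ K] [FiniteDimensional ℂ K] [CompleteSpace K]
    (Φ : Module.End ℂ H →ₗ[ℂ] Module.End ℂ K) : Prop :=
  ∃ Ψ : (H →L[ℂ] H) →CP (K →L[ℂ] K), ∀ A : Module.End ℂ H,
    Ψ (LinearMap.toContinuousLinearMap A) = LinearMap.toContinuousLinearMap (Φ A)

/-- A quantum channel: a completely positive, trace preserving linear map. -/
structure IsQuantumChannel {H K : Type*}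
    [NormedAddCommGroup H] [InnerProductSpace ℂ H] [FiniteDimensional ℂ H] [CompleteSpace H]
    [NormedAddCommGroup K] [InnerProductSpace ℂ K] [FiniteDimensional ℂ K] [CompleteSpace K]
    (Φ : Module.End ℂ H →ₗ[ℂ] Module.End ℂ K) : Prop where
  completelyPositive : IsCompletelyPositive Φ
  trace_preserving : ∀ A : Module.End ℂ H, LinearMap.trace ℂ K (Φ A) = LinearMap.trace ℂ H A

/-- `Φ : End(H) → End(K)` is `G`-equivariant for the actions `A ↦ π(g) A π(g⁻¹)`. -/
def IsEquivariant {G H K : Type*} [Group G] [AddCommGroup H] [Module ℂ H]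
    [AddCommGroup K] [Module ℂ K] (π : Representation ℂ G H) (σ : Representation ℂ G K)
    (Φ : Module.End ℂ H →ₗ[ℂ] Module.End ℂ K) : Prop :=
  Representation.IsIntertwiningMap (π.linHom π) (σ.linHom σ) Φ

/-- An irreducibly covariant channel: a quantum channel that is equivariant with respect to two
irreducible representations. -/
structure IsIrreduciblyCovariantChannel {G H K : Type*} [Group G]
    [NormedAddCommGroup H] [InnerProductSpace ℂ H] [FiniteDimensional ℂ H] [CompleteSpace H]
    [NormedAddCommGroup K] [InnerProductSpace ℂ K] [FiniteDimensional ℂ K] [CompleteSpace K]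
    (π : Representation ℂ G H) (σ : Representation ℂ G K)
    (Φ : Module.End ℂ H →ₗ[ℂ] Module.End ℂ K) : Prop where
  irreducible_source : π.IsIrreducible
  irreducible_target : σ.IsIrreducible
  isQuantumChannel : IsQuantumChannel Φ
  isEquivariant : IsEquivariant π σ Φ

/-- The partial trace `End(V ⊗ W) → End(V)`, `A ⊗ B ↦ tr(B) A`. -/
def partialTrace (V W : Type*) [AddCommGroup V] [Module ℂ V] [FiniteDimensional ℂ V]
    [AddCommGroup W] [Module ℂ W] [FiniteDimensional ℂ W] :
    Module.End ℂ (V ⊗[ℂ] W) →ₗ[ℂ] Module.End ℂ V :=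
  (TensorProduct.rid ℂ (Module.End ℂ V)).toLinearMap ∘ₗ
    TensorProduct.map LinearMap.id (LinearMap.trace ℂ W) ∘ₗ
      (homTensorHomEquiv ℂ V W V W).symm.toLinearMap

theorem partialTrace_map (V W : Type*) [AddCommGroup V] [Module ℂ V] [FiniteDimensional ℂ V]
    [AddCommGroup W] [Module ℂ W] [FiniteDimensional ℂ W]
    (A : Module.End ℂ V) (B : Module.End ℂ W) :
    partialTrace V W (TensorProduct.map A B) = LinearMap.trace ℂ W B • A := by
  have h : (homTensorHomEquiv ℂ V W V W).symm (TensorProduct.map A B) = A ⊗ₜ[ℂ] B := by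
    rw [LinearEquiv.symm_apply_eq]
    simp
  simp [partialTrace, h]

/-! ### The irreducible representations of `SU(2)` on binary forms -/

/-- `SU(2)`. -/
abbrev SU2 := Matrix.specialUnitaryGroup (Fin 2) ℂ

/-- `P m`: complex homogeneous polynomials of degree `m` in two variables. -/
def P (m : ℕ) : Type := MvPolynomial.homogeneousSubmodule (Fin 2) ℂ m

instance (m : ℕ) : AddCommGroup (P m) :=
  inferInstanceAs (AddCommGroup (MvPolynomial.homogeneousSubmodule (Fin 2) ℂ m))

instance (m : ℕ) : Module ℂ (P m) :=
  inferInstanceAs (Module ℂ (MvPolynomial.homogeneousSubmodule (Fin 2) ℂ m))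

instance (m : ℕ) : FiniteDimensional ℂ (P m) :=
  Module.Finite.iff_fg.mpr (MvPolynomial.homogeneousSubmodule_fg (Fin 2) ℂ m)

/-- The inclusion of `P m` into the polynomial ring `ℂ[x₁, x₂]`. -/
def incl (m : ℕ) : P m →ₗ[ℂ] MvPolynomial (Fin 2) ℂ :=
  (MvPolynomial.homogeneousSubmodule (Fin 2) ℂ m).subtype

theorem incl_isHomogeneous {m : ℕ} (f : P m) : (incl m f).IsHomogeneous m := f.2

theorem incl_injective (m : ℕ) : Function.Injective (incl m) := Subtype.val_injective

/-- The exponent of the monomial `x₁ˡ x₂ᵐ⁻ˡ`. -/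
def expo (m l : ℕ) : Fin 2 →₀ ℕ := Finsupp.single 0 l + Finsupp.single 1 (m - l)

theorem expo_of_degree {m : ℕ} {d : Fin 2 →₀ ℕ} (hd : d.degree = m) :
    d 0 < m + 1 ∧ expo m (d 0) = d := by
  have h : d 0 + d 1 = m := by
    rw [← hd, Finsupp.degree_eq_sum]
    simp
  refine ⟨by omega, ?_⟩
  ext i
  fin_cases i
  · simp [expo]
  · simp [expo]
    omega

/-- The inner product with `⟨x₁ˡ x₂ᵐ⁻ˡ, x₁ᵏ x₂ᵐ⁻ᵏ⟩ = l! (m - l)! δ_{lk}`, linear in the second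
variable. -/
abbrev formCore (m : ℕ) : InnerProductSpace.Core ℂ (P m) where
  inner f g := ∑ l ∈ Finset.range (m + 1), ((l.factorial * (m - l).factorial : ℕ) : ℂ) *
    (star (MvPolynomial.coeff (expo m l) (incl m f)) * MvPolynomial.coeff (expo m l) (incl m g))
  conj_inner_symm f g := by
    simp only [map_sum, map_mul, starRingEnd_apply, star_star, star_natCast]
    exact Finset.sum_congr rfl fun l _ => by ring
  re_inner_nonneg f := by
    simp only [map_sum]
    refine Finset.sum_nonneg fun l _ => ?_
    rw [Complex.star_def, ← Complex.normSq_eq_conj_mul_self, ← Complex.ofReal_natCast,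
      ← Complex.ofReal_mul]
    exact mul_nonneg (Nat.cast_nonneg _) (Complex.normSq_nonneg _)
  add_left f g k := by
    simp only [map_add, MvPolynomial.coeff_add, star_add, ← Finset.sum_add_distrib]
    exact Finset.sum_congr rfl fun l _ => by ring
  smul_left f g c := by
    simp only [map_smul, MvPolynomial.coeff_smul, smul_eq_mul, star_mul,
      Finset.mul_sum, starRingEnd_apply]
    exact Finset.sum_congr rfl fun l _ => by ring
  definite f hf := by
    have hsum : ∑ l ∈ Finset.range (m + 1), ((l.factorial * (m - l).factorial : ℕ) : ℝ) *
        Complex.normSq (MvPolynomial.coeff (expo m l) (incl m f)) = 0 := by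
      have h : ((∑ l ∈ Finset.range (m + 1), ((l.factorial * (m - l).factorial : ℕ) : ℝ) *
        Complex.normSq (MvPolynomial.coeff (expo m l) (incl m f)) : ℝ) : ℂ) = 0 := by
        rw [← hf]
        push_cast
        exact Finset.sum_congr rfl fun l _ => by
          rw [Complex.normSq_eq_conj_mul_self]
          rfl
      exact_mod_cast h
    rw [Finset.sum_eq_zero_iff_of_nonneg
      fun l _ => mul_nonneg (Nat.cast_nonneg _) (Complex.normSq_nonneg _)] at hsum
    refine incl_injective m (MvPolynomial.ext _ _ fun d => ?_)
    by_cases hd : d.degree = m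
    · obtain ⟨h1, h2⟩ := expo_of_degree hd
      have h3 := hsum (d 0) (Finset.mem_range.mpr h1)
      rw [h2] at h3
      have h4 : (((d 0).factorial * (m - d 0).factorial : ℕ) : ℝ) ≠ 0 := by positivity
      simpa using (mul_eq_zero.mp h3).resolve_left h4
    · simpa using (incl_isHomogeneous f).coeff_eq_zero hd

instance (m : ℕ) : NormedAddCommGroup (P m) := (formCore m).toNormedAddCommGroup

instance (m : ℕ) : InnerProductSpace ℂ (P m) := InnerProductSpace.ofCore (formCore m).toCore

instance (m : ℕ) : CompleteSpace (P m) := FiniteDimensional.complete ℂ (P m)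

/-- The linear substitution `f(x₁, x₂) ↦ f((x₁, x₂) g)`. -/
def subst (g : Matrix (Fin 2) (Fin 2) ℂ) : MvPolynomial (Fin 2) ℂ →ₐ[ℂ] MvPolynomial (Fin 2) ℂ :=
  MvPolynomial.aeval fun j => ∑ i, MvPolynomial.C (g i j) * MvPolynomial.X i

theorem subst_isHomogeneous (g : Matrix (Fin 2) (Fin 2) ℂ) {m : ℕ} {f : MvPolynomial (Fin 2) ℂ}
    (hf : f.IsHomogeneous m) : (subst g f).IsHomogeneous m := by
  have h := hf.aeval (fun j => ∑ i, MvPolynomial.C (g i j) * MvPolynomial.X i) (n := 1)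
    fun j => MvPolynomial.IsHomogeneous.sum _ _ _ fun i _ => MvPolynomial.isHomogeneous_C_mul_X _ i
  simpa [subst] using h

theorem subst_one : subst 1 = AlgHom.id ℂ _ := by
  ext1 j
  fin_cases j <;> simp [subst]

theorem subst_mul (g h : Matrix (Fin 2) (Fin 2) ℂ) : subst (g * h) = (subst g).comp (subst h) := by
  ext1 j
  simp [subst, Matrix.mul_apply, Fin.sum_univ_two]
  ring

/-- The representation `ρ_m` of `SU(2)` on `P m`: `(ρ_m(g) f)(x₁, x₂) = f((x₁, x₂) g)`. -/
def rho (m : ℕ) : Representation ℂ SU2 (P m) where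
  toFun g := ((subst g.1).toLinearMap ∘ₗ incl m).codRestrict
    (MvPolynomial.homogeneousSubmodule (Fin 2) ℂ m)
    fun f => subst_isHomogeneous g.1 (incl_isHomogeneous f)
  map_one' := by
    ext1 f
    exact incl_injective m (congrArg (fun φ => φ (incl m f)) subst_one)
  map_mul' g h := by
    ext1 f
    exact incl_injective m (congrArg (fun φ => φ (incl m f)) (subst_mul g.1 h.1))

theorem incl_rho (m : ℕ) (g : SU2) (f : P m) : incl m (rho m g f) = subst g.1 (incl m f) := rfl

/-! ### The isometries `α_{m,n,h}` and the EPOSIC channels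

Polynomials in `x = (x₁, x₂)` and `y = (y₁, y₂)` are elements of `MvPolynomial (Fin 2 ⊕ Fin 2) ℂ`,
the `x`-variables being indexed by `Sum.inl` and the `y`-variables by `Sum.inr`. -/

/-- The coefficients `c_{m,n,h}`, meaningful for `h ≤ min m n`. They satisfy `c_{m,0,0} = 1` and,
for `n ≥ 1`, `(m + 1) n c_{m,n,h} = c_{m-1,n-1,h-1} + c_{m+1,n-1,h}`, where the first summand is
dropped for `h = 0` and the second one for `h = n`. -/
def cgCoeff : ℕ → ℕ → ℕ → ℝ
  | _, 0, _ => 1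
  | m, n + 1, h => (1 / ((m + 1) * (n + 1))) *
      ((if 0 < h then cgCoeff (m - 1) n (h - 1) else 0) +
        (if h < n + 1 then cgCoeff (m + 1) n h else 0))

/-- `Δ_{yx} = y₁ ∂/∂x₁ + y₂ ∂/∂x₂`. -/
def Δyx : Module.End ℂ (MvPolynomial (Fin 2 ⊕ Fin 2) ℂ) :=
  ∑ i : Fin 2, LinearMap.mulLeft ℂ (MvPolynomial.X (Sum.inr i)) ∘ₗ
    (MvPolynomial.pderiv (Sum.inl i)).toLinearMap

/-- `Γ_{xy}`: multiplication by `x₁ y₂ - y₁ x₂`. -/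
def Γxy : Module.End ℂ (MvPolynomial (Fin 2 ⊕ Fin 2) ℂ) :=
  LinearMap.mulLeft ℂ (MvPolynomial.X (Sum.inl 0) * MvPolynomial.X (Sum.inr 1) -
    MvPolynomial.X (Sum.inr 0) * MvPolynomial.X (Sum.inl 1))

/-- The projection of a polynomial onto its homogeneous component of degree `m`. -/
def homComp (m : ℕ) : MvPolynomial (Fin 2) ℂ →ₗ[ℂ] P m :=
  (MvPolynomial.homogeneousComponent m).codRestrict
    (MvPolynomial.homogeneousSubmodule (Fin 2) ℂ m) (MvPolynomial.homogeneousComponent_mem m)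

/-- The identification of polynomials in `x, y` of bidegree `(m, n)` with `P m ⊗ P n`, the inverse
of `f ⊗ g ↦ f(x) g(y)`. (On all of `ℂ[x, y]`: first take the component of bidegree `(m, n)`.) -/
def toTensor (m n : ℕ) : MvPolynomial (Fin 2 ⊕ Fin 2) ℂ →ₗ[ℂ] P m ⊗[ℂ] P n :=
  TensorProduct.map (homComp m) (homComp n) ∘ₗ
    (MvPolynomial.tensorEquivSum ℂ (Fin 2) (Fin 2) ℂ).symm.toLinearMap

theorem toTensor_mul (m n : ℕ) (f : P m) (g : P n) :
    toTensor m n (MvPolynomial.rename Sum.inl (incl m f) * MvPolynomial.rename Sum.inr (incl n g)) =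
      f ⊗ₜ[ℂ] g := by
  have h : ∀ a b : MvPolynomial (Fin 2) ℂ, (MvPolynomial.tensorEquivSum ℂ (Fin 2) (Fin 2) ℂ).symm
      (MvPolynomial.rename Sum.inl a * MvPolynomial.rename Sum.inr b) = a ⊗ₜ[ℂ] b := by
    intro a b
    rw [AlgEquiv.symm_apply_eq]
    have h1 : MvPolynomial.rename (R := ℂ) (Sum.inl : Fin 2 → Fin 2 ⊕ Fin 2) =
        (MvPolynomial.tensorEquivSum ℂ (Fin 2) (Fin 2) ℂ).toAlgHom.comp
          Algebra.TensorProduct.includeLeft := by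
      ext1 i
      simp
    have h2 : MvPolynomial.rename (R := ℂ) (Sum.inr : Fin 2 → Fin 2 ⊕ Fin 2) =
        (MvPolynomial.tensorEquivSum ℂ (Fin 2) (Fin 2) ℂ).toAlgHom.comp
          Algebra.TensorProduct.includeRight := by
      ext1 i
      simp
    rw [h1, h2]
    simp [← map_mul]
  have hc : ∀ (k : ℕ) (p : P k), homComp k (incl k p) = p := fun k p =>
    incl_injective k (MvPolynomial.homogeneousComponent_eq_self (incl_isHomogeneous p))
  simp [toTensor, h, hc]

/-- The map `α_{m,n,h} : P r → P m ⊗ P n`, where `r = m + n - 2h` and `h ≤ min m n`: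
`f(x) ↦ √c_{m,n,h} Γ_{xy}^h Δ_{yx}^{n-h} f(x)`. -/
def alpha (r m n h : ℕ) : P r →ₗ[ℂ] P m ⊗[ℂ] P n :=
  (Real.sqrt (cgCoeff m n h) : ℂ) •
    (toTensor m n ∘ₗ (Γxy ^ h) ∘ₗ (Δyx ^ (n - h)) ∘ₗ
      (MvPolynomial.rename Sum.inl).toLinearMap ∘ₗ incl r)

/-- The map `Φ_{m,n,h} : End(P r) → End(P m)`, `A ↦ Tr_{P n}(α A α*)`, where `r = m + n - 2h`
and `h ≤ min m n`. -/
def eposic (r m n h : ℕ) : Module.End ℂ (P r) →ₗ[ℂ] Module.End ℂ (P m) where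
  toFun A := partialTrace (P m) (P n) (alpha r m n h ∘ₗ A ∘ₗ (alpha r m n h).adjoint)
  map_add' A B := by simp [LinearMap.add_comp, LinearMap.comp_add]
  map_smul' c A := by simp [LinearMap.smul_comp, LinearMap.comp_smul]

/-- `EC(r, m)`: the set of EPOSIC channels from `End(P r)` to `End(P m)`, that is, of all
`Φ_{m,n,h}` with `r = m + n - 2h` and `0 ≤ h ≤ min m n`. -/
def EC (r m : ℕ) : Set (Module.End ℂ (P r) →ₗ[ℂ] Module.End ℂ (P m)) :=
  {Φ | ∃ n h : ℕ, r + 2 * h = m + n ∧ h ≤ min m n ∧ Φ = eposic r m n h}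

end SU2Channel

end

/-! An equivariant map Φ : End(P_r) → End(P_m) amounts to an equivariant endomorphism of Hom(P_r,
P_m). The reshuffling `choi`, which on rank one operators reads choi Φ (φ ⊗ z) v = Φ(φ ⊗ v) z, is
injective and respects equivariance. By Clebsch–Gordan, Hom(P_r, P_m) is the multiplicity free sum
of the duals of P_n with n = r + m - 2j and 0 ≤ j ≤ min(r, m). Each summand comes from one EPOSIC
channel Φ_j: its Kraus operators form an equivariant map κ : P_n* → Hom(P_r, P_m), the trace pairing
with α* gives an equivariant Q in the opposite direction, and choi Φ_j = κ ∘ Q (`choi_stinespring`).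
Schur's lemma then gives Φ = Σ l_j Φ_j (`isEquivariant_eq_sum`). The decomposition itself is a
by-product: Q ∘ κ ≠ 0 because its trace is tr(α*α) = r + 1, the dimensions n + 1 are distinct, and
they add up to (r + 1)(m + 1).

If Φ is completely positive, the quadratic form of choi Φ is nonnegative. On the Kraus operators of
Φ_j only the j-th term contributes, whence l_j ≥ 0; trace preservation forces Σ l_j = 1.

Conversely, Φ_j is a channel because α is an isometry. Since Γ and Δ commute with unimodular
substitutions, α is equivariant, so α*α is a scalar on the irreducible P_r. The scalar is found from
the norm of α(x₁^r), through a closed form for c_{m,n,h} and a convolution identity for binomial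
coefficients. Irreducibility of ρ_m follows from the weight lines of the diagonal torus and one
rotation without zero entries. -/

noncomputable section

namespace SU2Channel

set_option linter.unusedSectionVars false

/-! ### Binary forms: unitarity and irreducibility of ρ_m. -/

section Forms

open MvPolynomial

/-- The coefficient of `x₁ˡ x₂ᵐ⁻ˡ`. -/
def formCoeff (m l : ℕ) : P m →ₗ[ℂ] ℂ := lcoeff ℂ (expo m l) ∘ₗ incl m

/-- The form `x₁ˡ x₂ᵐ⁻ˡ`. -/
def mono (m l : ℕ) : P m := homComp m (X 0 ^ l * X 1 ^ (m - l))

theorem incl_homComp {m : ℕ} {p : MvPolynomial (Fin 2) ℂ} (hp : p.IsHomogeneous m) :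
    incl m (homComp m p) = p :=
  homogeneousComponent_eq_self hp

theorem monomial_expo (m l : ℕ) (c : ℂ) :
    monomial (expo m l) c = C c * (X 0 ^ l * X 1 ^ (m - l)) := by
  rw [monomial_eq]
  congr 1
  rw [Finsupp.prod_fintype _ _ (by simp)]
  simp [expo]

theorem incl_mono {m l : ℕ} (h : l ≤ m) : incl m (mono m l) = X 0 ^ l * X 1 ^ (m - l) := by
  refine incl_homComp ?_
  have := ((isHomogeneous_X ℂ (0 : Fin 2)).pow l).mul ((isHomogeneous_X ℂ (1 : Fin 2)).pow (m - l))
  convert this using 1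
  omega

theorem expo_injective (m : ℕ) : Function.Injective (expo m) := fun a b h => by
  simpa [expo] using DFunLike.congr_fun h 0

theorem formCoeff_mono {m l : ℕ} (h : l ≤ m) (k : ℕ) :
    formCoeff m k (mono m l) = if k = l then 1 else 0 := by
  have h1 := monomial_expo m l 1
  rw [C_1, one_mul] at h1
  simp only [formCoeff, LinearMap.comp_apply, incl_mono h, lcoeff_apply, ← h1, coeff_monomial,
    (expo_injective m).eq_iff]
  simp [eq_comm]

theorem form_ext {m : ℕ} {f g : P m} (h : ∀ l ≤ m, formCoeff m l f = formCoeff m l g) : f = g := by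
  refine incl_injective m (MvPolynomial.ext _ _ fun d => ?_)
  by_cases hd : d.degree = m
  · obtain ⟨h1, h2⟩ := expo_of_degree hd
    rw [← h2]
    exact h _ (by omega)
  · rw [(incl_isHomogeneous f).coeff_eq_zero hd, (incl_isHomogeneous g).coeff_eq_zero hd]

theorem form_eq_sum (m : ℕ) (f : P m) :
    f = ∑ l ∈ Finset.range (m + 1), formCoeff m l f • mono m l := by
  refine form_ext fun k hk => ?_
  rw [map_sum, Finset.sum_eq_single k]
  · simp [formCoeff_mono hk]
  · intro l hl hlk
    simp [formCoeff_mono (Nat.lt_succ_iff.mp (Finset.mem_range.mp hl)), hlk.symm]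
  · simp; omega

theorem inner_def (m : ℕ) (f g : P m) :
    inner ℂ f g = ∑ l ∈ Finset.range (m + 1), ((l.factorial * (m - l).factorial : ℕ) : ℂ) *
      (star (formCoeff m l f) * formCoeff m l g) := rfl

theorem inner_mono {m l k : ℕ} (hl : l ≤ m) (hk : k ≤ m) :
    inner ℂ (mono m l) (mono m k) =
      if l = k then ((l.factorial * (m - l).factorial : ℕ) : ℂ) else 0 := by
  rw [inner_def, Finset.sum_eq_single l]
  · simp [formCoeff_mono hl, formCoeff_mono hk]
  · intro j _ hj
    simp [formCoeff_mono hl, hj]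
  · simp; omega

theorem finrank_P (m : ℕ) : Module.finrank ℂ (P m) = m + 1 := by
  let e : P m →ₗ[ℂ] Fin (m + 1) → ℂ := LinearMap.pi fun l => formCoeff m l
  have he : Function.Bijective e := by
    refine ⟨fun f g h => form_ext fun l hl => ?_, fun c => ⟨∑ l : Fin (m + 1), c l • mono m l, ?_⟩⟩
    · exact congrFun h ⟨l, by omega⟩
    · ext k
      simp only [e, LinearMap.pi_apply, map_sum, map_smul, smul_eq_mul]
      rw [Finset.sum_eq_single k]
      · simp [formCoeff_mono (Nat.lt_succ_iff.mp k.2)]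
      · intro l _ hlk
        simp [formCoeff_mono (Nat.lt_succ_iff.mp l.2), Fin.val_ne_of_ne hlk.symm]
      · simp
  rw [(LinearEquiv.ofBijective e he).finrank_eq, Module.finrank_fin_fun]

/-- The `m`-th power of a linear form. -/
def linPow (m : ℕ) (a : Fin 2 → ℂ) : P m := homComp m ((∑ i, C (a i) * X i) ^ m)

theorem incl_linPow (m : ℕ) (a : Fin 2 → ℂ) : incl m (linPow m a) = (∑ i, C (a i) * X i) ^ m := by
  refine incl_homComp ?_
  have h : (∑ i, C (a i) * X i : MvPolynomial (Fin 2) ℂ).IsHomogeneous 1 :=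
    IsHomogeneous.sum _ _ _ fun i _ => isHomogeneous_C_mul_X _ i
  simpa using h.pow m

theorem linPow_eq_sum (m : ℕ) (a : Fin 2 → ℂ) :
    linPow m a = ∑ l ∈ Finset.range (m + 1), (a 0 ^ l * a 1 ^ (m - l) * m.choose l) • mono m l := by
  apply incl_injective
  rw [incl_linPow, Fin.sum_univ_two, add_pow, map_sum]
  refine Finset.sum_congr rfl fun l hl => ?_
  rw [map_smul, incl_mono (Nat.lt_succ_iff.mp (Finset.mem_range.mp hl)), smul_eq_C_mul]
  simp only [mul_pow, C_mul, C_pow, map_natCast]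
  ring

theorem formCoeff_linPow {m l : ℕ} (h : l ≤ m) (a : Fin 2 → ℂ) :
    formCoeff m l (linPow m a) = a 0 ^ l * a 1 ^ (m - l) * m.choose l := by
  rw [linPow_eq_sum, map_sum, Finset.sum_eq_single l]
  · simp [formCoeff_mono h]
  · intro k hk hkl
    simp [formCoeff_mono (Nat.lt_succ_iff.mp (Finset.mem_range.mp hk)), hkl.symm]
  · simp; omega

theorem eval_form {m : ℕ} (f : P m) (a : Fin 2 → ℂ) :
    eval a (incl m f) = ∑ l ∈ Finset.range (m + 1), formCoeff m l f * (a 0 ^ l * a 1 ^ (m - l)) := by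
  conv_lhs => rw [form_eq_sum m f]
  rw [map_sum, map_sum]
  refine Finset.sum_congr rfl fun l hl => ?_
  rw [map_smul, incl_mono (Nat.lt_succ_iff.mp (Finset.mem_range.mp hl))]
  simp [smul_eq_C_mul]

/-- Reproducing property: the weights l!(m-l)! cancel the binomial coefficients of the power up to
m!, leaving the values of f. Since a polynomial over ℂ is determined by its values, unitarity of ρ_m
need only be tested against powers of linear forms, which ρ_m permutes. -/
theorem inner_linPow {m : ℕ} (f : P m) (a : Fin 2 → ℂ) :
    inner ℂ f (linPow m a) = m.factorial * star (eval (star a) (incl m f)) := by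
  rw [inner_def, eval_form, star_sum, Finset.mul_sum]
  refine Finset.sum_congr rfl fun l hl => ?_
  have hl' := Nat.lt_succ_iff.mp (Finset.mem_range.mp hl)
  rw [formCoeff_linPow hl', ← Nat.choose_mul_factorial_mul_factorial hl']
  simp only [star_mul', star_pow, Pi.star_apply, star_star]
  push_cast
  ring

theorem eq_zero_of_inner_linPow {m : ℕ} {f : P m} (h : ∀ a, inner ℂ f (linPow m a) = 0) :
    f = 0 := by
  apply incl_injective
  rw [map_zero]
  refine MvPolynomial.funext fun a => ?_
  have h1 := h (star a)
  rw [inner_linPow, star_star] at h1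
  simpa [Nat.factorial_ne_zero] using h1

theorem eval_subst (g : Matrix (Fin 2) (Fin 2) ℂ) (a : Fin 2 → ℂ) (p : MvPolynomial (Fin 2) ℂ) :
    eval a (subst g p) = eval (Matrix.vecMul a g) p := by
  have : (aeval a).comp (subst g) = (aeval (Matrix.vecMul a g) : _ →ₐ[ℂ] ℂ) := by
    ext1 j
    simp [subst, Matrix.vecMul, dotProduct, mul_comm]
  simpa [aeval_eq_eval] using congrArg (fun φ => φ p) this

theorem rho_linPow (m : ℕ) (g : SU2) (a : Fin 2 → ℂ) :
    rho m g (linPow m a) = linPow m (Matrix.mulVec g.1 a) := by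
  apply incl_injective
  rw [incl_rho, incl_linPow, incl_linPow, map_pow]
  congr 1
  simp [subst, Matrix.mulVec, dotProduct, Fin.sum_univ_two]
  ring

theorem inner_rho_linPow (m : ℕ) (g : SU2) (f : P m) (a : Fin 2 → ℂ) :
    inner ℂ (rho m g f) (rho m g (linPow m a)) = inner ℂ f (linPow m a) := by
  rw [rho_linPow, inner_linPow, inner_linPow, incl_rho, eval_subst, Matrix.star_mulVec,
    Matrix.vecMul_vecMul]
  have h : g.1.conjTranspose * g.1 = 1 := Matrix.mem_unitaryGroup_iff'.mp g.2.1
  rw [h, Matrix.vecMul_one]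

theorem adjoint_rho_comp_rho (m : ℕ) (g : SU2) :
    (rho m g).adjoint ∘ₗ rho m g = LinearMap.id := by
  ext1 f
  rw [← sub_eq_zero]
  refine eq_zero_of_inner_linPow fun a => ?_
  rw [inner_sub_left, LinearMap.comp_apply, LinearMap.adjoint_inner_left, inner_rho_linPow]
  simp

theorem adjoint_rho (m : ℕ) (g : SU2) : (rho m g).adjoint = rho m g⁻¹ := by
  have h : rho m g ∘ₗ rho m g⁻¹ = LinearMap.id := by
    rw [← Module.End.mul_eq_comp, ← map_mul, mul_inv_cancel, map_one]
    rfl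
  rw [← LinearMap.comp_id (rho m g).adjoint, ← h, ← LinearMap.comp_assoc, adjoint_rho_comp_rho,
    LinearMap.id_comp]

/-- An element of the diagonal torus of `SU(2)`. -/
def torus (t : ℂ) (ht : star t * t = 1) : SU2 :=
  ⟨!![t, 0; 0, star t], by
    rw [Matrix.mem_specialUnitaryGroup_iff, Matrix.mem_unitaryGroup_iff']
    constructor
    · ext i j
      fin_cases i <;> fin_cases j <;>
        simp [Matrix.mul_apply, Fin.sum_univ_two, Matrix.star_apply] <;>
        simpa [mul_comm] using ht
    · simpa [Matrix.det_fin_two, mul_comm] using ht⟩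

theorem rho_torus_mono {m l : ℕ} (h : l ≤ m) (t : ℂ) (ht : star t * t = 1) :
    rho m (torus t ht) (mono m l) = (t ^ l * star t ^ (m - l)) • mono m l := by
  apply incl_injective
  rw [incl_rho, map_smul, incl_mono h, smul_eq_C_mul]
  simp [subst, torus, Fin.sum_univ_two, mul_pow]
  ring

theorem exists_torus_eigenvalues_injOn (m : ℕ) : ∃ t : ℂ, star t * t = 1 ∧
    Set.InjOn (fun l => t ^ l * star t ^ (m - l)) (Finset.range (m + 1)) := by
  -- With t of order 2(m + 1), the l-th eigenvalue times t^m is t^(2l), and the exponents 2l ≤ 2m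
  -- stay below that order.
  have ht := Complex.isPrimitiveRoot_exp (2 * (m + 1)) (by omega)
  set t := Complex.exp (2 * Real.pi * Complex.I / (2 * (m + 1) : ℕ)) with htdef
  have h1 : star t * t = 1 := by
    have := Complex.norm_eq_one_of_pow_eq_one ht.pow_eq_one (by omega)
    have h2 := Complex.conj_mul' t
    rw [this] at h2
    simpa using h2
  refine ⟨t, h1, fun a ha b hb hab => ?_⟩
  have key : ∀ l ∈ Finset.range (m + 1), t ^ l * star t ^ (m - l) * t ^ m = t ^ (2 * l) := by
    intro l hl
    have hl := Finset.mem_range.mp hl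
    obtain ⟨k, rfl⟩ : ∃ k, m = l + k := ⟨m - l, by omega⟩
    have : (star t * t) ^ k = 1 := by rw [h1, one_pow]
    rw [add_tsub_cancel_left, pow_add, two_mul, pow_add]
    rw [mul_pow] at this
    linear_combination t ^ l * t ^ l * this
  have h2 : t ^ (2 * a) = t ^ (2 * b) := by
    rw [← key a ha, ← key b hb]
    exact congrArg (· * t ^ m) hab
  have ha' := Finset.mem_range.mp (Finset.mem_coe.mp ha)
  have hb' := Finset.mem_range.mp (Finset.mem_coe.mp hb)
  have := ht.pow_inj (by omega) (by omega) h2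
  omega

/-- An invariant subspace is stable under polynomials in a torus element. The torus eigenvalues
being distinct, a Lagrange basis polynomial projects onto a single weight line. -/
theorem mono_mem_of_mem {m : ℕ} {S : Submodule ℂ (P m)} (hS : ∀ g, ∀ f ∈ S, rho m g f ∈ S)
    {f : P m} (hf : f ∈ S) {l : ℕ} (hl : l ≤ m) (hfl : formCoeff m l f ≠ 0) : mono m l ∈ S := by
  obtain ⟨t, ht, hinj⟩ := exists_torus_eigenvalues_injOn m
  let v : ℕ → ℂ := fun l => t ^ l * star t ^ (m - l)
  let p := Lagrange.basis (Finset.range (m + 1)) v l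
  have hp : ∀ k ≤ m, Polynomial.aeval (rho m (torus t ht)) p (mono m k) =
      (if k = l then 1 else 0 : ℂ) • mono m k := by
    intro k hk
    have hk0 : mono m k ≠ 0 := fun h0 => by
      have := formCoeff_mono hk k
      rw [h0, map_zero, if_pos rfl] at this
      exact zero_ne_one this
    rw [Module.End.aeval_apply_of_hasEigenvector (Module.End.hasEigenvector_iff.mpr
      ⟨Module.End.mem_eigenspace_iff.mpr (rho_torus_mono hk t ht), hk0⟩)]
    congr 1
    have hk' : k ∈ Finset.range (m + 1) := Finset.mem_range.mpr (by omega)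
    split_ifs with h
    · subst h
      exact Lagrange.eval_basis_self (v := v) hinj hk'
    · exact Lagrange.eval_basis_of_ne (v := v) (Ne.symm h) hk'
  have h1 : Polynomial.aeval (rho m (torus t ht)) p f ∈ S :=
    Polynomial.aeval_apply_smul_mem_of_le_comap' (A := Module.End ℂ (P m)) hf p
      (rho m (torus t ht)) fun x hx => hS _ x hx
  rw [form_eq_sum m f, map_sum, Finset.sum_eq_single l] at h1
  · rw [map_smul, hp l hl, if_pos rfl, one_smul] at h1
    exact (S.smul_mem_iff hfl).mp h1
  · intro k hk hkl
    rw [map_smul, hp k (Nat.lt_succ_iff.mp (Finset.mem_range.mp hk)), if_neg hkl, zero_smul,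
      smul_zero]
  · simp; omega

/-- The rotation with cosine `3/5`. -/
def rotation : SU2 :=
  ⟨!![3 / 5, 4 / 5; -(4 / 5), 3 / 5], by
    rw [Matrix.mem_specialUnitaryGroup_iff, Matrix.mem_unitaryGroup_iff']
    constructor
    · ext i j
      fin_cases i <;> fin_cases j <;>
        simp [Matrix.mul_apply, Fin.sum_univ_two, Matrix.star_apply, map_ofNat] <;> norm_num
    · simp [Matrix.det_fin_two]; norm_num⟩

theorem formCoeff_self {m : ℕ} (f : P m) : formCoeff m m f = eval ![1, 0] (incl m f) := by
  rw [eval_form, Finset.sum_eq_single m]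
  · simp
  · intro l hl hlm
    have := Finset.mem_range.mp hl
    have : m - l ≠ 0 := by omega
    simp [this]
  · simp

theorem linPow_eq_mono (m : ℕ) : mono m m = linPow m ![1, 0] := by
  apply incl_injective
  rw [incl_mono le_rfl, incl_linPow]
  simp

/-- Since `rotation` has no zero entry, it sends every monomial to a form with nonzero coefficient
at x₁^m, and x₁^m to a form with all coefficients nonzero. Extracting weight components after each
rotation therefore reaches every monomial. -/
theorem eq_top_of_invariant {m : ℕ} {S : Submodule ℂ (P m)}
    (hS : ∀ g, ∀ f ∈ S, rho m g f ∈ S) (h : S ≠ ⊥) : S = ⊤ := by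
  obtain ⟨f, hf, hf0⟩ := S.ne_bot_iff.mp h
  obtain ⟨l, hl, hfl⟩ : ∃ l ≤ m, formCoeff m l f ≠ 0 := by
    by_contra! hcon
    exact hf0 (form_ext fun l hl => by rw [hcon l hl, map_zero])
  have h1 : mono m m ∈ S := by
    refine mono_mem_of_mem hS (hS rotation _ (mono_mem_of_mem hS hf hl hfl)) le_rfl ?_
    rw [formCoeff_self, incl_rho, eval_subst, incl_mono hl]
    simp [rotation]
  have h2 : ∀ k ≤ m, mono m k ∈ S := by
    intro k hk
    refine mono_mem_of_mem hS (hS rotation _ h1) hk ?_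
    rw [linPow_eq_mono, rho_linPow, formCoeff_linPow hk]
    simp [rotation, Matrix.mulVec, dotProduct, Fin.sum_univ_two, Nat.choose_eq_zero_iff, hk]
  rw [eq_top_iff]
  intro p _
  rw [form_eq_sum m p]
  exact S.sum_mem fun k hk => S.smul_mem _ (h2 k (Nat.lt_succ_iff.mp (Finset.mem_range.mp hk)))

end Forms

/-! ### Complete positivity: Choi's inequality and Kraus sums. -/

section CompletePositivity

variable {H K : Type*}
  [NormedAddCommGroup H] [InnerProductSpace ℂ H] [FiniteDimensional ℂ H] [CompleteSpace H]
  [NormedAddCommGroup K] [InnerProductSpace ℂ K] [FiniteDimensional ℂ K] [CompleteSpace K]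

theorem cstarMatrix_sum_apply {k A ι : Type*} [AddCommMonoid A] (s : Finset ι)
    (f : ι → CStarMatrix k k A) (p q : k) : (∑ i ∈ s, f i) p q = ∑ i ∈ s, f i p q :=
  map_sum ({ toFun := fun M => M p q, map_zero' := rfl, map_add' := fun _ _ => rfl } :
    CStarMatrix k k A →+ A) f s

/-- Positive elements are finite sums of N* N, and for N* N the double sum is Σ_l ‖Σ_i N_{li} x_i‖².
-/
theorem sum_inner_nonneg_of_cstarMatrix_nonneg {k : Type*} [Fintype k]
    {M : CStarMatrix k k (K →L[ℂ] K)} (hM : 0 ≤ M) (x : k → K) :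
    0 ≤ ∑ i, ∑ j, inner ℂ (x i) (M i j (x j)) := by
  rw [StarOrderedRing.nonneg_iff] at hM
  induction hM using AddSubmonoid.closure_induction with
  | zero => simp
  | add M N _ _ hM hN =>
    refine (add_nonneg hM hN).trans_eq ?_
    simp only [CStarMatrix.add_apply, add_apply, inner_add_right, Finset.sum_add_distrib]
  | mem M hM =>
    obtain ⟨N, rfl⟩ := hM
    have h : ∑ i, ∑ j, inner ℂ (x i) ((star N * N) i j (x j)) =
        ∑ l, inner ℂ (∑ i, N l i (x i)) (∑ j, N l j (x j)) := by
      simp only [CStarMatrix.mul_apply, CStarMatrix.star_apply, sum_apply,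
        inner_sum, sum_inner, mul_apply_eq_comp,
        ContinuousLinearMap.star_eq_adjoint, ContinuousLinearMap.adjoint_inner_right]
      rw [Finset.sum_congr rfl fun i _ => Finset.sum_comm, Finset.sum_comm]
      exact Finset.sum_congr rfl fun l _ => Finset.sum_comm
    refine h ▸ Finset.sum_nonneg fun l _ => ?_
    rw [inner_self_eq_norm_sq_to_K]
    positivity

theorem cstarMatrix_rankOne_nonneg {k : Type*} [Fintype k] (e : k → H) :
    0 ≤ (CStarMatrix.ofMatrix fun i j => InnerProductSpace.rankOne ℂ (e i) (e j) :
      CStarMatrix k k (H →L[ℂ] H)) := by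
  classical
  rcases subsingleton_or_nontrivial H with hH | hH
  · exact le_of_eq (CStarMatrix.ext fun i j => Subsingleton.elim _ _)
  rcases isEmpty_or_nonempty k with hk | ⟨⟨k₀⟩⟩
  · exact le_of_eq (CStarMatrix.ext fun i => hk.elim i)
  obtain ⟨u, hu⟩ := exists_norm_eq H zero_le_one
  -- A matrix with the single nonzero row |u⟩⟨e j|, where u is a unit vector, satisfies N* N = (|e
  -- i⟩⟨e j|).
  let N : CStarMatrix k k (H →L[ℂ] H) := CStarMatrix.ofMatrix fun l j =>
    if l = k₀ then InnerProductSpace.rankOne ℂ u (e j) else 0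
  have hN : ∀ l j, N l j = if l = k₀ then InnerProductSpace.rankOne ℂ u (e j) else 0 :=
    fun _ _ => rfl
  convert star_mul_self_nonneg N using 1
  ext i j v
  rw [CStarMatrix.mul_apply, Finset.sum_eq_single k₀]
  · rw [CStarMatrix.star_apply, hN, hN, if_pos rfl, if_pos rfl]
    simp only [ContinuousLinearMap.star_eq_adjoint, InnerProductSpace.adjoint_rankOne,
      mul_apply_eq_comp, InnerProductSpace.rankOne_apply, inner_smul_right,
      inner_self_eq_norm_sq_to_K, hu]
    simp only [RCLike.ofReal_one, one_pow, mul_one]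
    rfl
  · intro l _ hl
    rw [hN l j, if_neg hl, mul_zero]
  · simp

/-- The necessary half of Choi's criterion, and all that is used later of the complete positivity of
a covariant channel. -/
theorem IsCompletelyPositive.sum_inner_nonneg {Φ : Module.End ℂ H →ₗ[ℂ] Module.End ℂ K}
    (hΦ : IsCompletelyPositive Φ) {k : Type*} [Fintype k] (e : k → H) (x : k → K) :
    0 ≤ ∑ i, ∑ j, inner ℂ (x i)
      (Φ (InnerProductSpace.rankOne ℂ (e i) (e j)).toLinearMap (x j)) := by
  obtain ⟨Ψ, hΨ⟩ := hΦ
  have h := sum_inner_nonneg_of_cstarMatrix_nonneg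
    (CompletelyPositiveMap.map_cstarMatrix_nonneg Ψ _ (cstarMatrix_rankOne_nonneg e)) x
  convert h using 6 with i _ j _
  exact (congrArg (fun T : K →L[ℂ] K => T (x j))
    (hΨ (InnerProductSpace.rankOne ℂ (e i) (e j)).toLinearMap)).symm

theorem isCompletelyPositive_of_nonneg {Φ : Module.End ℂ H →ₗ[ℂ] Module.End ℂ K}
    (h : ∀ (k : ℕ) (N : CStarMatrix (Fin k) (Fin k) (H →L[ℂ] H)),
      0 ≤ (CStarMatrix.ofMatrix fun i j =>
        LinearMap.toContinuousLinearMap (Φ ((star N * N) i j).toLinearMap) :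
          CStarMatrix (Fin k) (Fin k) (K →L[ℂ] K))) :
    IsCompletelyPositive Φ := by
  refine ⟨{ toLinearMap := LinearMap.toContinuousLinearMap.toLinearMap ∘ₗ Φ ∘ₗ
              LinearMap.toContinuousLinearMap.symm.toLinearMap
            map_cstarMatrix_nonneg' := fun k M hM => ?_ }, fun A => rfl⟩
  rw [StarOrderedRing.nonneg_iff] at hM
  induction hM using AddSubmonoid.closure_induction with
  | zero =>
    refine le_of_eq (CStarMatrix.ext fun i j => ?_)
    simp
  | add M N _ _ hM hN =>
    refine (add_nonneg hM hN).trans_eq (CStarMatrix.ext fun i j => ?_)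
    simp
  | mem M hM =>
    obtain ⟨N, rfl⟩ := hM
    exact h k N

theorem IsCompletelyPositive.add {Φ Ψ : Module.End ℂ H →ₗ[ℂ] Module.End ℂ K}
    (hΦ : IsCompletelyPositive Φ) (hΨ : IsCompletelyPositive Ψ) :
    IsCompletelyPositive (Φ + Ψ) := by
  obtain ⟨Φ', h1⟩ := hΦ
  obtain ⟨Ψ', h2⟩ := hΨ
  refine ⟨{ toLinearMap := Φ'.toLinearMap + Ψ'.toLinearMap
            map_cstarMatrix_nonneg' := fun k M hM => ?_ }, fun A => ?_⟩
  · exact add_nonneg (Φ'.map_cstarMatrix_nonneg' k M hM) (Ψ'.map_cstarMatrix_nonneg' k M hM)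
  · rw [LinearMap.add_apply, map_add, ← h1, ← h2]
    rfl

theorem IsCompletelyPositive.smul {Φ : Module.End ℂ H →ₗ[ℂ] Module.End ℂ K}
    (hΦ : IsCompletelyPositive Φ) {c : ℝ} (hc : 0 ≤ c) :
    IsCompletelyPositive (c • Φ) := by
  obtain ⟨Φ', h1⟩ := hΦ
  refine ⟨{ toLinearMap := c • Φ'.toLinearMap
            map_cstarMatrix_nonneg' := fun k M hM => ?_ }, fun A => ?_⟩
  · exact smul_nonneg hc (Φ'.map_cstarMatrix_nonneg' k M hM)
  · refine ContinuousLinearMap.ext fun v => ?_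
    exact congrArg (fun T : K →L[ℂ] K => c • T v) (h1 A)

theorem isCompletelyPositive_of_kraus {ι : Type*} [Fintype ι]
    {Φ : Module.End ℂ H →ₗ[ℂ] Module.End ℂ K} (R : ι → H →ₗ[ℂ] K)
    (hR : ∀ A, Φ A = ∑ i, R i ∘ₗ A ∘ₗ (R i).adjoint) : IsCompletelyPositive Φ := by
  refine isCompletelyPositive_of_nonneg fun k N => ?_
  rcases subsingleton_or_nontrivial K with hK | hK
  · exact le_of_eq (CStarMatrix.ext fun i j => Subsingleton.elim _ _)
  obtain ⟨u, hu⟩ := exists_norm_eq K zero_le_one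
  let b := stdOrthonormalBasis ℂ H
  -- The operators N p q (R i)* go from K to H, so they do not form a matrix over End(K). Composing
  -- with |u⟩⟨b a| brings them back to K, and summing S* S over the orthonormal basis b restores R
  -- N* N R*.
  let S : ι → Fin (Module.finrank ℂ H) → CStarMatrix (Fin k) (Fin k) (K →L[ℂ] K) := fun i a =>
    CStarMatrix.ofMatrix fun p q =>
      InnerProductSpace.rankOne ℂ u (b a) ∘L N p q ∘L
        (LinearMap.toContinuousLinearMap (R i)).adjoint
  have h : 0 ≤ ∑ i, ∑ a, star (S i a) * S i a :=
    Finset.sum_nonneg fun i _ => Finset.sum_nonneg fun a _ => star_mul_self_nonneg _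
  have hS : ∀ i a p q, S i a p q = InnerProductSpace.rankOne ℂ u (b a) ∘L N p q ∘L
      (LinearMap.toContinuousLinearMap (R i)).adjoint := fun _ _ _ _ => rfl
  have hadj : ∀ i v, (LinearMap.toContinuousLinearMap (R i)).adjoint v = (R i).adjoint v :=
    fun _ _ => rfl
  refine h.trans_eq (CStarMatrix.ext fun p q => ContinuousLinearMap.ext fun v =>
    ext_inner_left ℂ fun w => ?_)
  have hl : inner ℂ w (Φ ((star N * N) p q).toLinearMap v) =
      ∑ i, ∑ l, inner ℂ (N l p ((R i).adjoint w)) (N l q ((R i).adjoint v)) := by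
    rw [hR, LinearMap.sum_apply, inner_sum]
    refine Finset.sum_congr rfl fun i _ => ?_
    rw [LinearMap.comp_apply, ← LinearMap.adjoint_inner_left]
    simp [CStarMatrix.mul_apply, CStarMatrix.star_apply, ContinuousLinearMap.star_eq_adjoint,
      inner_sum, ContinuousLinearMap.adjoint_inner_right]
  have hr : inner ℂ w ((∑ i, ∑ a, star (S i a) * S i a) p q v) =
      ∑ i, ∑ l, inner ℂ (N l p ((R i).adjoint w)) (N l q ((R i).adjoint v)) := by
    rw [cstarMatrix_sum_apply, sum_apply, inner_sum]
    refine Finset.sum_congr rfl fun i _ => ?_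
    rw [cstarMatrix_sum_apply, sum_apply, inner_sum]
    simp only [CStarMatrix.mul_apply, CStarMatrix.star_apply, sum_apply, inner_sum, hS,
      ContinuousLinearMap.star_eq_adjoint, mul_apply_eq_comp,
      ContinuousLinearMap.adjoint_inner_right]
    rw [Finset.sum_comm]
    refine Finset.sum_congr rfl fun l _ => ?_
    rw [← b.sum_inner_mul_inner]
    refine Finset.sum_congr rfl fun a _ => ?_
    simp [inner_smul_left, inner_smul_right, hadj, inner_self_eq_norm_sq_to_K, hu, mul_comm]
  exact hr.trans hl.symm

end CompletePositivity

/-! ### Rank one operators and partial traces. -/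

section RankOne

variable {V W : Type*} [AddCommGroup V] [Module ℂ V] [FiniteDimensional ℂ V]
  [AddCommGroup W] [Module ℂ W]

theorem sum_coord_smulRight {ι : Type*} [Fintype ι] (b : Module.Basis ι ℂ V) (A : V →ₗ[ℂ] W) :
    ∑ i, (b.coord i).smulRight (A (b i)) = A := by
  classical
  refine b.ext fun j => ?_
  rw [LinearMap.sum_apply, Finset.sum_eq_single j]
  · simp
  · intro i _ hij
    simp [Finsupp.single_eq_of_ne hij]
  · simp

/-- Two linear maps that agree on all rank one maps are equal. -/
theorem linearMap_ext_smulRight {U : Type*} [AddCommGroup U] [Module ℂ U]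
    {F G : (V →ₗ[ℂ] W) →ₗ[ℂ] U} (h : ∀ (φ : Module.Dual ℂ V) (w : W),
      F (φ.smulRight w) = G (φ.smulRight w)) : F = G := by
  ext1 A
  rw [← sum_coord_smulRight (Module.finBasis ℂ V) A, map_sum, map_sum]
  exact Finset.sum_congr rfl fun i _ => h _ _

/-- The tensor factors of `End(V ⊗ W)` generate it. -/
theorem linearMap_ext_map {U : Type*} [FiniteDimensional ℂ W] [AddCommGroup U] [Module ℂ U]
    {F G : Module.End ℂ (V ⊗[ℂ] W) →ₗ[ℂ] U}
    (h : ∀ (A : Module.End ℂ V) (B : Module.End ℂ W),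
      F (TensorProduct.map A B) = G (TensorProduct.map A B)) : F = G := by
  have h1 : F ∘ₗ (homTensorHomEquiv ℂ V W V W).toLinearMap =
      G ∘ₗ (homTensorHomEquiv ℂ V W V W).toLinearMap := by
    refine TensorProduct.ext' fun A B => ?_
    simpa using h A B
  ext1 X
  rw [← (homTensorHomEquiv ℂ V W V W).apply_symm_apply X]
  exact congrArg (fun φ => φ ((homTensorHomEquiv ℂ V W V W).symm X)) h1

theorem trace_partialTrace [FiniteDimensional ℂ W] (X : Module.End ℂ (V ⊗[ℂ] W)) :
    LinearMap.trace ℂ V (partialTrace V W X) = LinearMap.trace ℂ (V ⊗[ℂ] W) X := by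
  refine congrArg (fun φ => φ X) (linearMap_ext_map
    (F := LinearMap.trace ℂ V ∘ₗ partialTrace V W) (G := LinearMap.trace ℂ (V ⊗[ℂ] W))
    fun A B => ?_)
  rw [LinearMap.comp_apply, partialTrace_map, LinearMap.trace_tensorProduct', map_smul,
    smul_eq_mul, mul_comm]

/-- Contraction of the second tensor factor with a functional. -/
def contract (V : Type*) [AddCommGroup V] [Module ℂ V] (ψ : Module.Dual ℂ W) :
    V ⊗[ℂ] W →ₗ[ℂ] V :=
  (TensorProduct.rid ℂ V).toLinearMap ∘ₗ ψ.lTensor V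

theorem contract_tmul (ψ : Module.Dual ℂ W) (v : V) (w : W) :
    contract V ψ (v ⊗ₜ w) = ψ w • v := by
  simp [contract]

theorem partialTrace_eq_sum [FiniteDimensional ℂ W] {ι : Type*} [Fintype ι]
    (b : Module.Basis ι ℂ W) (X : Module.End ℂ (V ⊗[ℂ] W)) :
    partialTrace V W X =
      ∑ i, contract V (b.coord i) ∘ₗ X ∘ₗ (TensorProduct.mk ℂ V W).flip (b i) := by
  classical
  have h := linearMap_ext_map (F := partialTrace V W)
    (G := ∑ i, (LinearMap.llcomp ℂ V (V ⊗[ℂ] W) V (contract V (b.coord i))) ∘ₗ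
      (LinearMap.lcomp ℂ (V ⊗[ℂ] W) ((TensorProduct.mk ℂ V W).flip (b i)))) fun A B => ?_
  · rw [h]
    simp [LinearMap.sum_apply]
    rfl
  · rw [partialTrace_map, LinearMap.trace_eq_matrix_trace ℂ b, LinearMap.sum_apply]
    ext v
    simp [LinearMap.sum_apply, contract_tmul, Matrix.trace, LinearMap.toMatrix_apply,
      Finset.sum_smul]

theorem partialTrace_smulRight [FiniteDimensional ℂ W] (F : Module.Dual ℂ (V ⊗[ℂ] W))
    (t : V ⊗[ℂ] W) (v : V) :
    partialTrace V W (F.smulRight t) v = contract V (F ∘ₗ TensorProduct.mk ℂ V W v) t := by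
  let b := Module.finBasis ℂ W
  rw [partialTrace_eq_sum b, LinearMap.sum_apply]
  induction t with
  | zero => simp
  | add s t hs ht =>
    rw [map_add, ← hs, ← ht, ← Finset.sum_add_distrib]
    exact Finset.sum_congr rfl fun i _ => by simp
  | tmul x y =>
    rw [contract_tmul]
    simp only [LinearMap.comp_apply, LinearMap.smulRight_apply, map_smul, contract_tmul, smul_smul,
      ← Finset.sum_smul]
    congr 1
    conv_rhs => rw [← b.sum_repr y]
    simp only [map_sum, map_smul, smul_eq_mul]
    exact Finset.sum_congr rfl fun i _ => mul_comm _ _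

end RankOne

/-! ### The Choi operator on Hom(H, K). -/

section Swap

variable {H K : Type*} [AddCommGroup H] [Module ℂ H] [FiniteDimensional ℂ H]
  [AddCommGroup K] [Module ℂ K]

/-- The reshuffling `End(H) → End(K)` to `End(Hom(H, K))` that exchanges the two vector arguments
of a map evaluated at rank one operators; it is the Choi operator of the map. -/
def choi : (Module.End ℂ H →ₗ[ℂ] Module.End ℂ K) →ₗ[ℂ] Module.End ℂ (H →ₗ[ℂ] K) where
  toFun Φ :=
    { toFun := fun X =>
        { toFun := fun v => ∑ i, Φ (LinearMap.smulRightₗ ((Module.finBasis ℂ H).coord i) v)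
            (X (Module.finBasis ℂ H i))
          map_add' := fun v w => by simp only [map_add, LinearMap.add_apply, Finset.sum_add_distrib]
          map_smul' := fun c v => by
            simp only [map_smul, LinearMap.smul_apply, Finset.smul_sum, RingHom.id_apply] }
      map_add' := fun X Y => by ext; simp [Finset.sum_add_distrib]
      map_smul' := fun c X => by ext; simp [Finset.smul_sum] }
  map_add' Φ Ψ := by ext; simp [Finset.sum_add_distrib]
  map_smul' c Φ := by ext; simp [Finset.smul_sum]

/-- The basis chosen in the definition of `choi` drops out. As rank one maps span, this identity
characterises `choi`; injectivity and equivariance are read off from it. -/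
theorem choi_smulRight (Φ : Module.End ℂ H →ₗ[ℂ] Module.End ℂ K) (φ : Module.Dual ℂ H) (z : K)
    (v : H) : choi Φ (φ.smulRight z) v = Φ (φ.smulRight v) z := by
  let b := Module.finBasis ℂ H
  have h : ∑ i, (b.coord i).smulRight (φ.smulRight v (b i)) = φ.smulRight v :=
    sum_coord_smulRight b (φ.smulRight v)
  have h1 : choi Φ (φ.smulRight z) v =
      ∑ i, Φ ((b.coord i).smulRight v) (φ.smulRight z (b i)) := rfl
  rw [h1, ← h, map_sum, LinearMap.sum_apply]
  refine Finset.sum_congr rfl fun i _ => ?_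
  have h2 : (b.coord i).smulRight (φ.smulRight v (b i)) = φ (b i) • (b.coord i).smulRight v := by
    ext w
    simp [smul_comm (φ (b i))]
  rw [h2, map_smul]
  simp

theorem choi_apply (Φ : Module.End ℂ H →ₗ[ℂ] Module.End ℂ K) (X : H →ₗ[ℂ] K) {ι : Type*}
    [Fintype ι] (b : Module.Basis ι ℂ H) (v : H) :
    choi Φ X v = ∑ i, Φ ((b.coord i).smulRight v) (X (b i)) := by
  conv_lhs => rw [← sum_coord_smulRight b X]
  simp [LinearMap.sum_apply, choi_smulRight]

theorem choi_injective : Function.Injective (choi (H := H) (K := K)) := by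
  intro Φ Ψ h
  refine linearMap_ext_smulRight fun φ v => ?_
  ext z
  rw [← choi_smulRight, ← choi_smulRight, h]

theorem choi_intertwines {G : Type*} [Group G] {π : Representation ℂ G H}
    {σ : Representation ℂ G K} {Φ : Module.End ℂ H →ₗ[ℂ] Module.End ℂ K}
    (hΦ : IsEquivariant π σ Φ) :
    Representation.IsIntertwiningMap (π.linHom σ) (π.linHom σ) (choi Φ) := by
  refine ⟨fun g X => ?_⟩
  refine congrArg (fun φ => φ X) (linearMap_ext_smulRight
    (F := choi Φ ∘ₗ π.linHom σ g) (G := π.linHom σ g ∘ₗ choi Φ) fun φ z => ?_)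
  have h1 : π.linHom σ g (φ.smulRight z) = (φ ∘ₗ π g⁻¹).smulRight (σ g z) := by
    ext v
    simp [Representation.linHom_apply]
  ext v
  rw [LinearMap.comp_apply, LinearMap.comp_apply, h1, choi_smulRight]
  -- The operator is rewritten as a conjugate by g, so that equivariance of Φ applies.
  have h2 : (φ ∘ₗ π g⁻¹).smulRight v = π.linHom π g (φ.smulRight (π g⁻¹ v)) := by
    ext v
    simp [Representation.linHom_apply]
  rw [h2, hΦ.isIntertwining]
  simp [Representation.linHom_apply, choi_smulRight]

end Swap

/-! ### Schur's lemma and multiplicity free decompositions. -/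

section Schur

variable {G V W : Type*} [Group G] [AddCommGroup V] [Module ℂ V] [AddCommGroup W] [Module ℂ W]
  {π : Representation ℂ G V} {σ : Representation ℂ G W}

theorem isIrreducible_of_invariant [Nontrivial V]
    (h : ∀ S : Submodule ℂ V, (∀ g, ∀ v ∈ S, π g v ∈ S) → S = ⊥ ∨ S = ⊤) : π.IsIrreducible where
  exists_pair_ne := by
    refine ⟨⊥, ⊤, fun hbot => ?_⟩
    have := congrArg Subrepresentation.toSubmodule hbot
    exact bot_ne_top (α := Submodule ℂ V) this
  eq_bot_or_eq_top S :=
    (h S.toSubmodule fun g _ hv => S.apply_mem_toSubmodule g hv).imp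
      (fun h => Subrepresentation.toSubmodule_injective h)
      (fun h => Subrepresentation.toSubmodule_injective h)

theorem eq_bot_or_eq_top_of_invariant (hπ : π.IsIrreducible) {S : Submodule ℂ V}
    (h : ∀ g, ∀ v ∈ S, π g v ∈ S) : S = ⊥ ∨ S = ⊤ :=
  (hπ.eq_bot_or_eq_top ⟨S, fun g _ hv => h g _ hv⟩).imp
    (congrArg Subrepresentation.toSubmodule) (congrArg Subrepresentation.toSubmodule)

theorem nontrivial_of_isIrreducible (hπ : π.IsIrreducible) : Nontrivial V := by
  by_contra h
  rw [not_nontrivial_iff_subsingleton] at h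
  obtain ⟨S, T, hST⟩ := hπ.exists_pair_ne
  exact hST (Subrepresentation.toSubmodule_injective (Subsingleton.elim _ _))

/-- A nonzero intertwiner of irreducibles is bijective. Dimension alone is enough to tell the
representations P_n apart. -/
theorem intertwining_eq_zero (hπ : π.IsIrreducible) (hσ : σ.IsIrreducible)
    (hd : Module.finrank ℂ V ≠ Module.finrank ℂ W) {f : V →ₗ[ℂ] W}
    (hf : Representation.IsIntertwiningMap π σ f) : f = 0 := by
  have h := Representation.IsIrreducible.bijective_or_eq_zero
    (LinearMap.intertwiningMap_of_isIntertwiningMap π σ f hf.isIntertwining)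
  rcases h with h | h
  · exact absurd (LinearEquiv.ofBijective f h).finrank_eq hd
  · exact congrArg Representation.IntertwiningMap.toLinearMap h

theorem intertwining_eq_smul_id [FiniteDimensional ℂ V] (hπ : π.IsIrreducible) {f : V →ₗ[ℂ] V}
    (hf : Representation.IsIntertwiningMap π π f) : ∃ c : ℂ, f = c • LinearMap.id := by
  have := nontrivial_of_isIrreducible hπ
  obtain ⟨c, hc⟩ := Module.End.exists_eigenvalue f
  refine ⟨c, ?_⟩
  rcases eq_bot_or_eq_top_of_invariant hπ (S := Module.End.eigenspace f c) (fun g v hv => by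
    rw [Module.End.mem_eigenspace_iff] at hv ⊢
    rw [hf.isIntertwining, hv, map_smul]) with h | h
  · exact absurd h hc
  · ext v
    exact Module.End.mem_eigenspace_iff.mp (h ▸ Submodule.mem_top)

/-- The coannihilator of an invariant subspace of the dual is invariant in V, and in finite
dimension the annihilator recovers the subspace from it. -/
theorem isIrreducible_dual [FiniteDimensional ℂ V] (hπ : π.IsIrreducible) :
    π.dual.IsIrreducible := by
  have := nontrivial_of_isIrreducible hπ
  refine isIrreducible_of_invariant fun S hS => ?_
  rw [← Subspace.dualCoannihilator_dualAnnihilator_eq (W := S)]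
  rcases eq_bot_or_eq_top_of_invariant hπ (S := S.dualCoannihilator) (fun g v hv => by
    rw [Submodule.mem_dualCoannihilator] at hv ⊢
    intro ψ hψ
    have := hv _ (hS g⁻¹ ψ hψ)
    rwa [Representation.dual_apply, inv_inv] at this) with h | h
  · right
    rw [h, Submodule.dualAnnihilator_bot]
  · left
    rw [h, Submodule.dualAnnihilator_top]

/-- In a multiplicity free decomposition, given by embeddings `κ i` and projections `Q i`, every
intertwining operator is a combination of the operators `κ i ∘ Q i`. -/
theorem intertwining_eq_sum_of_multiplicityFree {ι : Type*} [Fintype ι] {D : ι → Type*}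
    [∀ i, AddCommGroup (D i)] [∀ i, Module ℂ (D i)] [∀ i, FiniteDimensional ℂ (D i)]
    [FiniteDimensional ℂ V] {δ : ∀ i, Representation ℂ G (D i)} (hδ : ∀ i, (δ i).IsIrreducible)
    (hd : Function.Injective fun i => Module.finrank ℂ (D i))
    (hsum : ∑ i, Module.finrank ℂ (D i) = Module.finrank ℂ V)
    {κ : ∀ i, D i →ₗ[ℂ] V} (hκ : ∀ i, Representation.IsIntertwiningMap (δ i) π (κ i))
    {Q : ∀ i, V →ₗ[ℂ] D i} (hQ : ∀ i, Representation.IsIntertwiningMap π (δ i) (Q i))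
    (hQκ : ∀ i, Q i ∘ₗ κ i ≠ 0) {J : V →ₗ[ℂ] V} (hJ : Representation.IsIntertwiningMap π π J) :
    ∃ l : ι → ℂ, J = ∑ i, l i • κ i ∘ₗ Q i := by
  classical
  have hne : ∀ i j, i ≠ j → ∀ T : V →ₗ[ℂ] V, Representation.IsIntertwiningMap π π T →
      ∀ d, Q j (T (κ i d)) = 0 := fun i j hij T hT d => by
    have := intertwining_eq_zero (hδ i) (hδ j) (hd.ne hij) (f := Q j ∘ₗ T ∘ₗ κ i) ⟨fun g v => by
      simp [(hκ i).isIntertwining, hT.isIntertwining, (hQ j).isIntertwining]⟩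
    exact congrArg (fun f => f d) this
  have hself : ∀ i, ∀ T : V →ₗ[ℂ] V, Representation.IsIntertwiningMap π π T →
      ∃ c : ℂ, ∀ d, Q i (T (κ i d)) = c • d := fun i T hT => by
    obtain ⟨c, hc⟩ := intertwining_eq_smul_id (hδ i) (f := Q i ∘ₗ T ∘ₗ κ i) ⟨fun g v => by
      simp [(hκ i).isIntertwining, hT.isIntertwining, (hQ i).isIntertwining]⟩
    exact ⟨c, fun d => congrArg (fun f => f d) hc⟩
  have hid : Representation.IsIntertwiningMap π π (LinearMap.id : V →ₗ[ℂ] V) := ⟨fun _ _ => rfl⟩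
  choose μ hμ using fun i => hself i LinearMap.id hid
  choose c hc using fun i => hself i J hJ
  have hμ0 : ∀ i, μ i ≠ 0 := fun i h => hQκ i (LinearMap.ext fun d => by
    simpa [h] using hμ i d)
  let F : (∀ i, D i) →ₗ[ℂ] V := ∑ i, κ i ∘ₗ LinearMap.proj i
  have hF : ∀ d, F d = ∑ i, κ i (d i) := fun d => by simp [F, LinearMap.sum_apply]
  have hQF : ∀ T : V →ₗ[ℂ] V, Representation.IsIntertwiningMap π π T → ∀ d j,
      Q j (T (F d)) = Q j (T (κ j (d j))) := fun T hT d j => by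
    rw [hF, map_sum, map_sum, Finset.sum_eq_single j]
    · exact fun i _ hij => hne i j hij T hT _
    · simp
  have hinj : Function.Injective F := by
    rw [← LinearMap.ker_eq_bot, LinearMap.ker_eq_bot']
    intro d h0
    funext j
    have h1 := hQF LinearMap.id hid d j
    rw [hμ, h0, map_zero, map_zero] at h1
    exact (smul_eq_zero.mp h1.symm).resolve_left (hμ0 j)
  -- The dimension count shows that the summands exhaust V, with no appeal to complete reducibility.
  have hsurj : Function.Surjective F :=
    (LinearMap.injective_iff_surjective_of_finrank_eq_finrank
      (by rw [Module.finrank_pi_fintype, hsum])).mp hinj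
  have hexp : ∀ x, x = ∑ i, (μ i)⁻¹ • κ i (Q i x) := fun x => by
    obtain ⟨d, rfl⟩ := hsurj x
    rw [hF d]
    refine Finset.sum_congr rfl fun i _ => ?_
    have := hQF LinearMap.id hid d i
    rw [hμ, hF] at this
    rw [LinearMap.id_apply] at this
    rw [this, map_smul, inv_smul_smul₀ (hμ0 i)]
  -- One factor (μ i)⁻¹ comes from expanding J x along the κ i, the other from recovering the
  -- component d i of x as (μ i)⁻¹ • Q i x.
  refine ⟨fun i => (μ i)⁻¹ * (μ i)⁻¹ * c i, LinearMap.ext fun x => ?_⟩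
  rw [hexp (J x), LinearMap.sum_apply]
  refine Finset.sum_congr rfl fun i _ => ?_
  obtain ⟨d, rfl⟩ := hsurj x
  have h1 := hQF LinearMap.id hid d i
  rw [hμ, LinearMap.id_apply] at h1
  rw [hQF J hJ, hc, LinearMap.smul_apply, LinearMap.comp_apply, h1, map_smul, map_smul,
    smul_smul, smul_smul]
  congr 1
  field_simp [hμ0 i]

end Schur

/-! ### Stinespring maps, their Kraus operators and Choi operators. -/

section Channel

variable {H K N : Type*}
  [NormedAddCommGroup H] [InnerProductSpace ℂ H] [FiniteDimensional ℂ H] [CompleteSpace H]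
  [NormedAddCommGroup K] [InnerProductSpace ℂ K] [FiniteDimensional ℂ K] [CompleteSpace K]
  [NormedAddCommGroup N] [InnerProductSpace ℂ N] [FiniteDimensional ℂ N] [CompleteSpace N]

/-- The map `A ↦ Tr_N(α A α*)` with Stinespring operator `α : H → K ⊗ N`. -/
def stinespring (α : H →ₗ[ℂ] K ⊗[ℂ] N) : Module.End ℂ H →ₗ[ℂ] Module.End ℂ K where
  toFun A := partialTrace K N (α ∘ₗ A ∘ₗ α.adjoint)
  map_add' A B := by simp [LinearMap.add_comp, LinearMap.comp_add]
  map_smul' c A := by simp [LinearMap.smul_comp, LinearMap.comp_smul]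

theorem trace_stinespring {α : H →ₗ[ℂ] K ⊗[ℂ] N} (hα : α.adjoint ∘ₗ α = LinearMap.id)
    (A : Module.End ℂ H) : LinearMap.trace ℂ K (stinespring α A) = LinearMap.trace ℂ H A := by
  have h : stinespring α A = partialTrace K N (α ∘ₗ A ∘ₗ α.adjoint) := rfl
  rw [h, trace_partialTrace, LinearMap.trace_comp_comm', LinearMap.comp_assoc, hα,
    LinearMap.comp_id]

/-- Used twice: it turns Tr_N(α A α*) into a Kraus sum over an orthonormal basis of N, and it turns
the trace pairing at w into the Hilbert–Schmidt product with a Kraus operator. -/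
theorem adjoint_contract_comp (α : H →ₗ[ℂ] K ⊗[ℂ] N) (w : N) :
    (contract K (innerSL ℂ w).toLinearMap ∘ₗ α).adjoint =
      α.adjoint ∘ₗ (TensorProduct.mk ℂ K N).flip w := by
  rw [LinearMap.adjoint_comp]
  congr 1
  rw [eq_comm, LinearMap.eq_adjoint_iff]
  intro z t
  induction t with
  | zero => simp
  | add s t hs ht => rw [inner_add_right, hs, ht, map_add, inner_add_right]
  | tmul x y => simp [contract_tmul, inner_smul_right, mul_comm]

theorem isCompletelyPositive_stinespring (α : H →ₗ[ℂ] K ⊗[ℂ] N) :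
    IsCompletelyPositive (stinespring α) := by
  let b := stdOrthonormalBasis ℂ N
  refine isCompletelyPositive_of_kraus
    (fun i => contract K (innerSL ℂ (b i)).toLinearMap ∘ₗ α) fun A => ?_
  change partialTrace K N (α ∘ₗ A ∘ₗ α.adjoint) = _
  rw [partialTrace_eq_sum b.toBasis]
  refine Finset.sum_congr rfl fun i _ => ?_
  rw [adjoint_contract_comp]
  have h : b.toBasis.coord i = (innerSL ℂ (b i)).toLinearMap := by
    ext v
    simp [OrthonormalBasis.repr_apply_apply]
  rw [h]
  simp [LinearMap.comp_assoc]

/-- The Kraus operators of `stinespring α`. -/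
def kraus (α : H →ₗ[ℂ] K ⊗[ℂ] N) : Module.Dual ℂ N →ₗ[ℂ] (H →ₗ[ℂ] K) where
  toFun ψ := contract K ψ ∘ₗ α
  map_add' ψ χ := by simp [contract, LinearMap.lTensor_add, LinearMap.comp_add, LinearMap.add_comp]
  map_smul' c ψ := by
    simp [contract, LinearMap.lTensor_smul, LinearMap.comp_smul, LinearMap.smul_comp]

theorem kraus_apply (α : H →ₗ[ℂ] K ⊗[ℂ] N) (ψ : Module.Dual ℂ N) :
    kraus α ψ = contract K ψ ∘ₗ α := rfl

/-- The trace pairing of `Hom(H, K)` with the operators `β (· ⊗ p)`. -/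
def tracePairing (β : K ⊗[ℂ] N →ₗ[ℂ] H) : (H →ₗ[ℂ] K) →ₗ[ℂ] Module.Dual ℂ N where
  toFun X :=
    { toFun := fun p => LinearMap.trace ℂ H (β ∘ₗ (TensorProduct.mk ℂ K N).flip p ∘ₗ X)
      map_add' := fun p q => by simp [LinearMap.comp_add, LinearMap.add_comp]
      map_smul' := fun c p => by simp [LinearMap.comp_smul, LinearMap.smul_comp] }
  map_add' X Y := by ext; simp [LinearMap.comp_add]
  map_smul' c X := by ext; simp [LinearMap.comp_smul]

theorem tracePairing_apply (β : K ⊗[ℂ] N →ₗ[ℂ] H) (X : H →ₗ[ℂ] K) (p : N) :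
    tracePairing β X p = LinearMap.trace ℂ H (β ∘ₗ (TensorProduct.mk ℂ K N).flip p ∘ₗ X) := rfl

/-- The channel sends φ ⊗ v to the partial trace of the rank one operator (φ ∘ α*) ⊗ αv. At z this
contracts αv with the functional p ↦ φ(α*(z ⊗ p)), which is the trace pairing of φ ⊗ z. The Choi
operator thus factors through the dual of N. -/
theorem choi_stinespring (α : H →ₗ[ℂ] K ⊗[ℂ] N) :
    choi (stinespring α) = kraus α ∘ₗ tracePairing α.adjoint := by
  refine linearMap_ext_smulRight fun φ z => ?_
  ext v
  rw [choi_smulRight]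
  have h : stinespring α (φ.smulRight v) =
      partialTrace K N ((φ ∘ₗ α.adjoint).smulRight (α v)) := by
    change partialTrace K N _ = _
    congr 1
    ext x
    simp
  rw [h, partialTrace_smulRight, LinearMap.comp_apply, kraus_apply, LinearMap.comp_apply]
  congr 2
  ext p
  rw [tracePairing_apply]
  have h2 : α.adjoint ∘ₗ (TensorProduct.mk ℂ K N).flip p ∘ₗ φ.smulRight z =
      φ.smulRight (α.adjoint (z ⊗ₜ p)) := by
    ext x
    simp
  rw [h2, LinearMap.trace_smulRight]
  simp

/-- The left side is the trace of `tracePairing β ∘ₗ kraus α`; the sum over i is a resolution of the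
identity of N placed between β and α. For an isometry α and β = α* it equals dim H, so the composite
cannot vanish. -/
theorem tracePairing_kraus_sum {ι : Type*} [Fintype ι] (b : Module.Basis ι ℂ N)
    (α : H →ₗ[ℂ] K ⊗[ℂ] N) (β : K ⊗[ℂ] N →ₗ[ℂ] H) :
    ∑ i, tracePairing β (kraus α (b.coord i)) (b i) = LinearMap.trace ℂ H (β ∘ₗ α) := by
  simp only [tracePairing_apply, kraus_apply, ← map_sum]
  congr 1
  have h : ∑ i, (TensorProduct.mk ℂ K N).flip (b i) ∘ₗ contract K (b.coord i) =
      LinearMap.id := by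
    refine TensorProduct.ext' fun k n => ?_
    rw [LinearMap.sum_apply, LinearMap.id_apply]
    conv_rhs => rw [← b.sum_repr n, TensorProduct.tmul_sum]
    refine Finset.sum_congr rfl fun i _ => ?_
    simp [contract_tmul]
  conv_rhs => rw [← LinearMap.id_comp α, ← h]
  ext x
  simp [LinearMap.sum_apply]

theorem tracePairing_comp_kraus_ne_zero [Nontrivial H] {α : H →ₗ[ℂ] K ⊗[ℂ] N}
    (hα : α.adjoint ∘ₗ α = LinearMap.id) : tracePairing α.adjoint ∘ₗ kraus α ≠ 0 := by
  intro h0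
  have h := tracePairing_kraus_sum (Module.finBasis ℂ N) α α.adjoint
  rw [hα, Finset.sum_eq_zero] at h
  · rw [← Module.End.one_eq_id, LinearMap.trace_one] at h
    exact (Nat.cast_ne_zero.mpr (Module.finrank_pos (R := ℂ) (M := H)).ne') h.symm
  · intro i _
    exact congrArg (fun f => f ((Module.finBasis ℂ N).coord i) (Module.finBasis ℂ N i)) h0

/-- With X the Kraus operator attached to w, the quantity is the Hilbert–Schmidt product ⟨X, choi Φ
X⟩. In an orthonormal basis it becomes the double sum of Choi's criterion. -/
theorem tracePairing_choi_kraus_nonneg {Φ : Module.End ℂ H →ₗ[ℂ] Module.End ℂ K}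
    (hΦ : IsCompletelyPositive Φ) (α : H →ₗ[ℂ] K ⊗[ℂ] N) (w : N) :
    0 ≤ tracePairing α.adjoint (choi Φ (kraus α (innerSL ℂ w).toLinearMap)) w := by
  let X := kraus α (innerSL ℂ w).toLinearMap
  let b := stdOrthonormalBasis ℂ H
  refine (hΦ.sum_inner_nonneg b fun i => X (b i)).trans_eq ?_
  rw [tracePairing_apply, ← LinearMap.comp_assoc, ← adjoint_contract_comp, ← kraus_apply,
    LinearMap.trace_eq_sum_inner _ b]
  refine Finset.sum_congr rfl fun i _ => ?_
  rw [LinearMap.comp_apply, LinearMap.adjoint_inner_right, choi_apply Φ _ b.toBasis, inner_sum]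
  refine Finset.sum_congr rfl fun j _ => ?_
  have h : (b.toBasis.coord j).smulRight (b i) =
      (InnerProductSpace.rankOne ℂ (b i) (b j)).toLinearMap := by
    ext v
    simp [OrthonormalBasis.repr_apply_apply]
  rw [h]
  simp [X]

variable {G : Type*} [Group G] {π : Representation ℂ G H} {σ : Representation ℂ G K}
  {τ : Representation ℂ G N}

theorem kraus_intertwines {α : H →ₗ[ℂ] K ⊗[ℂ] N}
    (hα : Representation.IsIntertwiningMap π (σ.tprod τ) α) :
    Representation.IsIntertwiningMap τ.dual (π.linHom σ) (kraus α) := by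
  refine ⟨fun g ψ => LinearMap.ext fun v => ?_⟩
  have h : ∀ t, contract K (τ.dual g ψ) t = σ g (contract K ψ (σ.tprod τ g⁻¹ t)) := by
    intro t
    induction t with
    | zero => simp
    | add s t hs ht => rw [map_add, hs, ht, map_add, map_add, map_add]
    | tmul x y =>
      simp only [contract_tmul, Representation.dual_apply, Representation.tprod_apply,
        TensorProduct.map_tmul, map_smul, Representation.self_inv_apply]
      rfl
  rw [kraus_apply, LinearMap.comp_apply, h, ← hα.isIntertwining]
  simp [Representation.linHom_apply, kraus_apply]

theorem tracePairing_intertwines {β : K ⊗[ℂ] N →ₗ[ℂ] H}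
    (hβ : Representation.IsIntertwiningMap (σ.tprod τ) π β) :
    Representation.IsIntertwiningMap (π.linHom σ) τ.dual (tracePairing β) := by
  refine ⟨fun g X => LinearMap.ext fun p => ?_⟩
  have h : β ∘ₗ (TensorProduct.mk ℂ K N).flip p ∘ₗ π.linHom σ g X =
      (π g ∘ₗ (β ∘ₗ (TensorProduct.mk ℂ K N).flip (τ g⁻¹ p) ∘ₗ X)) ∘ₗ π g⁻¹ := by
    ext v
    have := hβ.isIntertwining g (X (π g⁻¹ v) ⊗ₜ τ g⁻¹ p)
    rw [Representation.tprod_apply, TensorProduct.map_tmul, Representation.self_inv_apply] at this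
    simp [Representation.linHom_apply, this]
  have h1 : π g⁻¹ ∘ₗ π g = LinearMap.id := by
    ext v; simp
  rw [tracePairing_apply, h, LinearMap.trace_comp_comm', ← LinearMap.comp_assoc, h1,
    LinearMap.id_comp, Representation.dual_apply]
  rfl

theorem adjoint_intertwines {H' : Type*} [NormedAddCommGroup H'] [InnerProductSpace ℂ H']
    [FiniteDimensional ℂ H'] {π' : Representation ℂ G H'} (hπ : ∀ g, (π g).adjoint = π g⁻¹)
    (hπ' : ∀ g, (π' g).adjoint = π' g⁻¹) {f : H →ₗ[ℂ] H'}
    (hf : Representation.IsIntertwiningMap π π' f) :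
    Representation.IsIntertwiningMap π' π f.adjoint := by
  refine ⟨fun g v => ext_inner_left ℂ fun w => ?_⟩
  rw [LinearMap.adjoint_inner_right, ← LinearMap.adjoint_inner_left, hπ', ← hf.isIntertwining,
    ← LinearMap.adjoint_inner_right, ← hπ, LinearMap.adjoint_inner_left]

theorem adjoint_tprod (hσ : ∀ g, (σ g).adjoint = σ g⁻¹) (hτ : ∀ g, (τ g).adjoint = τ g⁻¹) (g : G) :
    (σ.tprod τ g).adjoint = σ.tprod τ g⁻¹ := by
  rw [Representation.tprod_apply, Representation.tprod_apply, TensorProduct.adjoint_map, hσ, hτ]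

theorem isEquivariant_stinespring {α : H →ₗ[ℂ] K ⊗[ℂ] N}
    (hα : Representation.IsIntertwiningMap π (σ.tprod τ) α)
    (hα' : Representation.IsIntertwiningMap (σ.tprod τ) π α.adjoint) :
    IsEquivariant π σ (stinespring α) := by
  refine ⟨fun g A => ?_⟩
  have h1 : α ∘ₗ π.linHom π g A ∘ₗ α.adjoint =
      (σ.tprod τ).linHom (σ.tprod τ) g (α ∘ₗ A ∘ₗ α.adjoint) := by
    ext v w
    have h := hα.isIntertwining g (A (α.adjoint (σ g⁻¹ v ⊗ₜ τ g⁻¹ w)))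
    rw [Representation.tprod_apply] at h
    simp [Representation.linHom_apply, ← hα'.isIntertwining, h]
  change partialTrace K N _ = σ.linHom σ g (partialTrace K N _)
  rw [h1]
  refine congrArg (fun φ => φ (α ∘ₗ A ∘ₗ α.adjoint)) (linearMap_ext_map
    (F := partialTrace K N ∘ₗ (σ.tprod τ).linHom (σ.tprod τ) g)
    (G := σ.linHom σ g ∘ₗ partialTrace K N) fun B C => ?_)
  have h2 : (σ.tprod τ).linHom (σ.tprod τ) g (TensorProduct.map B C) =
      TensorProduct.map (σ.linHom σ g B) (τ.linHom τ g C) := by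
    refine TensorProduct.ext' fun x y => ?_
    simp [Representation.linHom_apply, Representation.tprod_apply]
  -- The traced out factor contributes nothing, the trace being invariant under conjugation by τ g.
  have h3 : LinearMap.trace ℂ N (τ.linHom τ g C) = LinearMap.trace ℂ N C := by
    have h4 : τ g⁻¹ ∘ₗ τ g = LinearMap.id := by
      ext v; simp
    rw [Representation.linHom_apply, LinearMap.trace_comp_comm', LinearMap.comp_assoc, h4,
      LinearMap.comp_id]
  rw [LinearMap.comp_apply, LinearMap.comp_apply, h2, partialTrace_map, partialTrace_map, h3,
    map_smul]

end Channel

/-! ### Equivariance and normalisation of α. -/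

section Alpha

open MvPolynomial

/-- The simultaneous linear substitution in the two groups of variables. -/
def subst₂ (g : Matrix (Fin 2) (Fin 2) ℂ) :
    MvPolynomial (Fin 2 ⊕ Fin 2) ℂ →ₐ[ℂ] MvPolynomial (Fin 2 ⊕ Fin 2) ℂ :=
  aeval (Sum.elim (fun j => ∑ i, C (g i j) * X (Sum.inl i)) fun j => ∑ i, C (g i j) * X (Sum.inr i))

theorem subst₂_rename_inl (g : Matrix (Fin 2) (Fin 2) ℂ) (p : MvPolynomial (Fin 2) ℂ) :
    subst₂ g (rename Sum.inl p) = rename Sum.inl (subst g p) := by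
  have h : (subst₂ g).comp (rename Sum.inl) = (rename Sum.inl).comp (subst g) := by
    ext1 j
    simp [subst₂, subst]
  exact congrArg (fun φ => φ p) h

theorem Γxy_apply (p : MvPolynomial (Fin 2 ⊕ Fin 2) ℂ) :
    Γxy p = (X (Sum.inl 0) * X (Sum.inr 1) - X (Sum.inr 0) * X (Sum.inl 1)) * p := rfl

theorem Δyx_apply (p : MvPolynomial (Fin 2 ⊕ Fin 2) ℂ) :
    Δyx p = ∑ i : Fin 2, X (Sum.inr i) * pderiv (Sum.inl i) p := by
  simp [Δyx]

theorem Δyx_mul (p q : MvPolynomial (Fin 2 ⊕ Fin 2) ℂ) : Δyx (p * q) = Δyx p * q + p * Δyx q := by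
  simp only [Δyx_apply, Fin.sum_univ_two, pderiv_mul]
  ring

theorem Δyx_C (a : ℂ) : Δyx (C a) = 0 := by simp [Δyx_apply]

theorem Δyx_X_inl (i : Fin 2) : Δyx (X (Sum.inl i)) = X (Sum.inr i) := by
  rw [Δyx_apply]
  fin_cases i <;> simp [pderiv_X, Pi.single_apply]

theorem Δyx_X_inr (i : Fin 2) : Δyx (X (Sum.inr i)) = 0 := by
  simp [Δyx_apply, pderiv_X]

/-- The form x₁y₂ - y₁x₂ is a determinant, so the substitution multiplies it by det g. -/
theorem subst₂_Γxy {g : Matrix (Fin 2) (Fin 2) ℂ} (hg : g.det = 1)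
    (p : MvPolynomial (Fin 2 ⊕ Fin 2) ℂ) : subst₂ g (Γxy p) = Γxy (subst₂ g p) := by
  have hg' : (C (g 0 0) * C (g 1 1) - C (g 0 1) * C (g 1 0) :
      MvPolynomial (Fin 2 ⊕ Fin 2) ℂ) = 1 := by
    rw [← C_mul, ← C_mul, ← C_sub, ← Matrix.det_fin_two, hg, C_1]
  rw [Γxy_apply, Γxy_apply, map_mul]
  congr 1
  simp only [subst₂, map_sub, map_mul, aeval_X, Sum.elim_inl, Sum.elim_inr, Fin.sum_univ_two]
  linear_combination (X (Sum.inl 0) * X (Sum.inr 1) - X (Sum.inr 0) * X (Sum.inl 1)) * hg'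

/-- Δ is a derivation taking x_i to y_i and killing y_i, and g acts in the same way on both groups
of variables; comparing on generators suffices. -/
theorem subst₂_Δyx (g : Matrix (Fin 2) (Fin 2) ℂ) (p : MvPolynomial (Fin 2 ⊕ Fin 2) ℂ) :
    subst₂ g (Δyx p) = Δyx (subst₂ g p) := by
  induction p using MvPolynomial.induction_on with
  | C a => simp [Δyx_C, subst₂]
  | add p q hp hq => simp only [map_add, hp, hq]
  | mul_X p i hp =>
    have hX : subst₂ g (Δyx (X i)) = Δyx (subst₂ g (X i)) := by
      rcases i with i | i
      · rw [Δyx_X_inl]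
        simp only [subst₂, aeval_X, Sum.elim_inl, Sum.elim_inr, map_sum, Δyx_mul, Δyx_C, Δyx_X_inl,
          zero_mul, zero_add]
      · rw [Δyx_X_inr]
        simp only [subst₂, aeval_X, Sum.elim_inr, map_sum, Δyx_mul, Δyx_C, Δyx_X_inr,
          zero_mul, mul_zero, zero_add, Finset.sum_const_zero, map_zero]
    rw [Δyx_mul, map_add, map_mul, map_mul, hp, map_mul, Δyx_mul, hX]

theorem homComp_subst (m : ℕ) (g : SU2) (p : MvPolynomial (Fin 2) ℂ) :
    homComp m (subst g.1 p) = rho m g (homComp m p) := by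
  have h : ∀ k (q : MvPolynomial (Fin 2) ℂ), q.IsHomogeneous k →
      homComp m (subst g.1 q) = rho m g (homComp m q) := by
    intro k q hq
    apply incl_injective
    rw [incl_rho]
    by_cases hk : k = m
    · subst hk
      rw [incl_homComp hq, incl_homComp (subst_isHomogeneous g.1 hq)]
    · have h0 : ∀ q' : MvPolynomial (Fin 2) ℂ, q'.IsHomogeneous k → incl m (homComp m q') = 0 :=
        fun q' hq' => (homogeneousComponent_of_mem hq').trans (if_neg (Ne.symm hk))
      rw [h0 q hq, h0 _ (subst_isHomogeneous g.1 hq), map_zero]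
  rw [← sum_homogeneousComponent p]
  simp only [map_sum]
  exact Finset.sum_congr rfl fun k _ => h k _ (homogeneousComponent_isHomogeneous k p)

theorem toTensor_tensorEquivSum (m n : ℕ) (p q : MvPolynomial (Fin 2) ℂ) :
    toTensor m n (tensorEquivSum ℂ (Fin 2) (Fin 2) ℂ (p ⊗ₜ q)) = homComp m p ⊗ₜ homComp n q := by
  simp [toTensor]

theorem subst₂_tensorEquivSum (g : Matrix (Fin 2) (Fin 2) ℂ) (p q : MvPolynomial (Fin 2) ℂ) :
    subst₂ g (tensorEquivSum ℂ (Fin 2) (Fin 2) ℂ (p ⊗ₜ q)) =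
      tensorEquivSum ℂ (Fin 2) (Fin 2) ℂ (subst g p ⊗ₜ subst g q) := by
  have h : (subst₂ g).comp (tensorEquivSum ℂ (Fin 2) (Fin 2) ℂ).toAlgHom =
      (tensorEquivSum ℂ (Fin 2) (Fin 2) ℂ).toAlgHom.comp
        (Algebra.TensorProduct.map (subst g) (subst g)) := by
    ext j
    · fin_cases j <;>
      simp [subst₂, subst, TensorProduct.add_tmul, ← smul_eq_C_mul, ← TensorProduct.smul_tmul']
    · fin_cases j <;>
      simp [subst₂, subst, TensorProduct.tmul_add, ← smul_eq_C_mul]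
  exact congrArg (fun φ => φ (p ⊗ₜ q)) h

theorem toTensor_subst₂ (m n : ℕ) (g : SU2) (p : MvPolynomial (Fin 2 ⊕ Fin 2) ℂ) :
    toTensor m n (subst₂ g.1 p) = (rho m).tprod (rho n) g (toTensor m n p) := by
  obtain ⟨t, rfl⟩ := (tensorEquivSum ℂ (Fin 2) (Fin 2) ℂ).surjective p
  induction t with
  | zero => simp
  | add s t hs ht => simp only [map_add, hs, ht]
  | tmul p q =>
    rw [subst₂_tensorEquivSum, toTensor_tensorEquivSum, toTensor_tensorEquivSum, homComp_subst,
      homComp_subst, Representation.tprod_apply, TensorProduct.map_tmul]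

theorem alpha_apply (r m n h : ℕ) (f : P r) : alpha r m n h f =
    (Real.sqrt (cgCoeff m n h) : ℂ) •
      toTensor m n ((Γxy ^ h) ((Δyx ^ (n - h)) (rename Sum.inl (incl r f)))) := rfl

theorem alpha_intertwines (r m n h : ℕ) :
    Representation.IsIntertwiningMap (rho r) ((rho m).tprod (rho n)) (alpha r m n h) := by
  refine ⟨fun g f => ?_⟩
  have hΔ : ∀ k p, (Δyx ^ k) (subst₂ g.1 p) = subst₂ g.1 ((Δyx ^ k) p) := by
    intro k
    induction k with
    | zero => simp
    | succ k ih => intro p; rw [pow_succ, Module.End.mul_apply, ← subst₂_Δyx, ih]; rfl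
  have hΓ : ∀ k p, (Γxy ^ k) (subst₂ g.1 p) = subst₂ g.1 ((Γxy ^ k) p) := by
    intro k
    induction k with
    | zero => simp
    | succ k ih =>
      intro p
      rw [pow_succ, Module.End.mul_apply,
        ← subst₂_Γxy (Matrix.mem_specialUnitaryGroup_iff.mp g.2).2, ih]
      rfl
  rw [alpha_apply, alpha_apply, incl_rho, ← subst₂_rename_inl, hΔ, hΓ, toTensor_subst₂, map_smul]

theorem Γxy_pow_apply (h : ℕ) (p : MvPolynomial (Fin 2 ⊕ Fin 2) ℂ) :
    (Γxy ^ h) p = (X (Sum.inl 0) * X (Sum.inr 1) - X (Sum.inr 0) * X (Sum.inl 1)) ^ h * p := by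
  induction h generalizing p with
  | zero => simp
  | succ h ih => rw [pow_succ, Module.End.mul_apply, ih, Γxy_apply, pow_succ, mul_assoc]

theorem Δyx_pow_X_pow (r k : ℕ) (hk : k ≤ r) :
    (Δyx ^ k) (X (Sum.inl 0) ^ r) =
      C (r.descFactorial k : ℂ) * (X (Sum.inl 0) ^ (r - k) * X (Sum.inr 0) ^ k) := by
  induction k with
  | zero => simp
  | succ k ih =>
    have hX : ∀ j, Δyx (X (Sum.inl 0) ^ (j + 1)) =
        C ((j + 1 : ℕ) : ℂ) * (X (Sum.inl 0) ^ j * X (Sum.inr 0)) := by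
      intro j
      induction j with
      | zero => simp [Δyx_X_inl]
      | succ j ih =>
        rw [pow_succ, Δyx_mul, ih, Δyx_X_inl]
        simp only [map_natCast]
        push_cast
        ring
    have hY : ∀ j, Δyx (X (Sum.inr 0) ^ j) = 0 := by
      intro j
      induction j with
      | zero => simpa using Δyx_C 1
      | succ j ih => rw [pow_succ, Δyx_mul, ih, Δyx_X_inr, zero_mul, mul_zero, add_zero]
    obtain ⟨s, rfl⟩ : ∃ s, r = s + 1 + k := ⟨r - k - 1, by omega⟩
    rw [pow_succ', Module.End.mul_apply, ih (by omega), Δyx_mul, Δyx_C, Δyx_mul, hY,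
      Nat.add_sub_cancel, hX, Nat.descFactorial_succ, Nat.add_sub_cancel,
      show s + 1 + k - (k + 1) = s by omega]
    simp only [map_natCast]
    push_cast
    ring

theorem toTensor_monomial (m n a b c d : ℕ) :
    toTensor m n (X (Sum.inl 0) ^ a * X (Sum.inl 1) ^ b * (X (Sum.inr 0) ^ c * X (Sum.inr 1) ^ d)) =
      homComp m (X 0 ^ a * X 1 ^ b) ⊗ₜ homComp n (X 0 ^ c * X 1 ^ d) := by
  rw [← toTensor_tensorEquivSum]
  congr 1
  have h : ∀ p q : MvPolynomial (Fin 2) ℂ, p ⊗ₜ[ℂ] q = (p ⊗ₜ[ℂ] 1) * (1 ⊗ₜ[ℂ] q) := by simp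
  have h1 : ∀ p q : MvPolynomial (Fin 2) ℂ, (p * q) ⊗ₜ[ℂ] (1 : MvPolynomial (Fin 2) ℂ) =
      (p ⊗ₜ[ℂ] 1) * (q ⊗ₜ[ℂ] 1) := by simp
  have h2 : ∀ p q : MvPolynomial (Fin 2) ℂ, (1 : MvPolynomial (Fin 2) ℂ) ⊗ₜ[ℂ] (p * q) =
      (1 ⊗ₜ[ℂ] p) * (1 ⊗ₜ[ℂ] q) := by simp
  have h3 : ∀ (p : MvPolynomial (Fin 2) ℂ) k, (p ^ k) ⊗ₜ[ℂ] (1 : MvPolynomial (Fin 2) ℂ) =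
      (p ⊗ₜ[ℂ] 1) ^ k := by simp
  have h4 : ∀ (p : MvPolynomial (Fin 2) ℂ) k, (1 : MvPolynomial (Fin 2) ℂ) ⊗ₜ[ℂ] (p ^ k) =
      (1 ⊗ₜ[ℂ] p) ^ k := by simp
  rw [h, h1, h2, h3, h3, h4, h4]
  simp only [map_mul, map_pow, tensorEquivSum_X_tmul_one, tensorEquivSum_one_tmul_X]

/-- The parameters m = p + h, n = q + h, r = p + q absorb the constraint h ≤ min m n. The falling
factorial comes from Δ^q, the alternating sum from the binomial expansion of Γ^h. -/
theorem alpha_highestWeight (p q h : ℕ) :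
    alpha (p + q) (p + h) (q + h) h (mono (p + q) (p + q)) =
      (Real.sqrt (cgCoeff (p + h) (q + h) h) : ℂ) • ∑ k ∈ Finset.range (h + 1),
        (((p + q).descFactorial q : ℂ) * ((-1) ^ k * h.choose k)) •
          (mono (p + h) (p + h - k) ⊗ₜ[ℂ] mono (q + h) (q + k)) := by
  rw [alpha_apply, incl_mono le_rfl, Nat.sub_self, pow_zero, mul_one, Nat.add_sub_cancel, map_pow,
    rename_X, Δyx_pow_X_pow _ _ (by omega), Nat.add_sub_cancel, Γxy_pow_apply, sub_eq_neg_add,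
    add_pow, Finset.sum_mul, map_sum]
  congr 1
  refine Finset.sum_congr rfl fun k hk => ?_
  have hk := Finset.mem_range.mp hk
  have h1 : mono (p + h) (p + h - k) = homComp (p + h) (X 0 ^ (p + h - k) * X 1 ^ k) := by
    rw [mono, show p + h - (p + h - k) = k by omega]
  have h2 : mono (q + h) (q + k) = homComp (q + h) (X 0 ^ (q + k) * X 1 ^ (h - k)) := by
    rw [mono, show q + h - (q + k) = h - k by omega]
  rw [h1, h2, ← toTensor_monomial, ← map_smul, smul_eq_C_mul]
  congr 1
  rw [show p + h - k = p + (h - k) by omega]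
  simp only [neg_pow (X (Sum.inr 0) * X (Sum.inl 1) : MvPolynomial (Fin 2 ⊕ Fin 2) ℂ), mul_pow,
    C_mul, C_pow, C_neg, C_1, map_natCast]
  ring

/-- In these parameters the recursion leads from (p, q, h) to (p, q, h - 1) and (p + 1, q - 1, h).
Both lower q + h by one, hence the induction on q + h. -/
theorem cgCoeff_eq (p q h : ℕ) : cgCoeff (p + h) (q + h) h =
    ((p + q + 1) * p.factorial : ℝ) / (h.factorial * q.factorial * (p + q + h + 1).factorial) := by
  obtain ⟨N, hN⟩ : ∃ N, q + h = N := ⟨_, rfl⟩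
  induction N generalizing p q h with
  | zero =>
    obtain ⟨rfl, rfl⟩ : q = 0 ∧ h = 0 := by omega
    simp only [cgCoeff, add_zero, Nat.factorial_succ, Nat.factorial_zero]
    push_cast
    have := Nat.factorial_ne_zero p
    field_simp
    ring
  | succ N ih =>
    rw [hN, cgCoeff]
    have hp := Nat.factorial_ne_zero p
    have hN' : (N : ℝ) = q + h - 1 := by
      rw [eq_sub_iff_add_eq]
      exact_mod_cast hN.symm
    rcases h with _ | h <;> rcases q with _ | q
    · omega
    · have e := ih (p + 1) q 0 (by omega)
      rw [show q + 0 = N by omega] at e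
      rw [if_neg (lt_irrefl 0), if_pos (by omega), add_zero, zero_add, add_zero] at *
      rw [e, show p + 1 + q + 1 = p + q + 1 + 1 by ring, show p + (q + 1) + 1 = p + q + 1 + 1 by ring,
        hN']
      have := Nat.factorial_ne_zero q
      have := Nat.factorial_ne_zero (p + q + 1 + 1)
      simp only [Nat.factorial_succ p, Nat.factorial_succ q]
      push_cast
      field_simp
      ring
    · have e := ih p 0 h (by omega)
      rw [show 0 + h = N by omega] at e
      rw [if_pos (by omega), if_neg (by omega), Nat.add_sub_cancel, add_zero,
        show p + (h + 1) - 1 = p + h by omega, e]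
      rw [hN', show p + 0 + (h + 1) + 1 = p + 0 + h + 1 + 1 by ring]
      have := Nat.factorial_ne_zero h
      have := Nat.factorial_ne_zero (p + 0 + h + 1)
      simp only [Nat.factorial_succ h, Nat.factorial_succ (p + 0 + h + 1)]
      push_cast
      field_simp
      ring
    · have hN'' : (N : ℝ) = q + h + 1 := by exact_mod_cast (by omega : N = q + h + 1)
      have e1 := ih p (q + 1) h (by omega)
      have e2 := ih (p + 1) q (h + 1) (by omega)
      rw [show q + 1 + h = N by omega] at e1
      rw [show q + (h + 1) = N by omega] at e2
      rw [if_pos (by omega), if_pos (by omega), Nat.add_sub_cancel,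
        show p + (h + 1) - 1 = p + h by omega, show p + (h + 1) + 1 = p + 1 + (h + 1) by ring, e1, e2,
        hN'', show p + (q + 1) + (h + 1) + 1 = p + (q + 1) + h + 1 + 1 by ring,
        show p + 1 + q + (h + 1) + 1 = p + (q + 1) + h + 1 + 1 by ring]
      have := Nat.factorial_ne_zero h
      have := Nat.factorial_ne_zero q
      have := Nat.factorial_ne_zero (p + (q + 1) + h + 1)
      simp only [Nat.factorial_succ h, Nat.factorial_succ q, Nat.factorial_succ p,
        Nat.factorial_succ (p + (q + 1) + h + 1)]
      push_cast
      field_simp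
      ring

/-- Coefficient of X^h in (1 - X)^(-(q+1)) (1 - X)^(-(p+1)) = (1 - X)^(-(p+q+2)). -/
theorem sum_choose_mul_choose (p q h : ℕ) :
    ∑ k ∈ Finset.range (h + 1), (p + (h - k)).choose p * (q + k).choose q =
      (p + q + h + 1).choose h := by
  have e := congrArg Units.val (PowerSeries.invOneSubPow_add (S := ℤ) (q + 1) (p + 1))
  rw [Units.val_mul, show q + 1 + (p + 1) = p + q + 1 + 1 by ring] at e
  simp only [PowerSeries.invOneSubPow_val_succ_eq_mk_add_choose] at e
  have e2 := congrArg (PowerSeries.coeff h) e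
  rw [PowerSeries.coeff_mul, Finset.Nat.sum_antidiagonal_eq_sum_range_succ_mk] at e2
  simp only [PowerSeries.coeff_mk] at e2
  rw [show p + q + h + 1 = h + (p + q + 1) by ring, Nat.choose_symm_add,
    show h + (p + q + 1) = p + q + 1 + h by ring]
  zify
  rw [e2]
  exact Finset.sum_congr rfl fun k _ => mul_comm _ _

/-- Each summand is the constant h!² p! q! times a product of two binomial coefficients, so the sum
reduces to `sum_choose_mul_choose`. -/
theorem norm_alpha_sum (p q h : ℕ) :
    (∑ k ∈ Finset.range (h + 1), (h.choose k : ℝ) ^ 2 *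
      ((p + h - k).factorial * k.factorial * ((q + k).factorial * (h - k).factorial))) *
        (p + q + 1).factorial =
      h.factorial * p.factorial * q.factorial * (p + q + h + 1).factorial := by
  have key : ∀ k ∈ Finset.range (h + 1), (h.choose k : ℝ) ^ 2 *
      ((p + h - k).factorial * k.factorial * ((q + k).factorial * (h - k).factorial)) =
      (h.factorial ^ 2 * p.factorial * q.factorial) *
        ((p + (h - k)).choose p * (q + k).choose q : ℕ) := by
    intro k hk
    have hk := Nat.lt_succ_iff.mp (Finset.mem_range.mp hk)
    rw [show p + h - k = p + (h - k) by omega]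
    have e1 := Nat.choose_mul_factorial_mul_factorial hk
    have e2 := Nat.add_choose_mul_factorial_mul_factorial p (h - k)
    have e3 := Nat.add_choose_mul_factorial_mul_factorial q k
    rw [← e2, ← e3, Nat.choose_symm_add (a := p) (b := h - k), Nat.choose_symm_add (a := q) (b := k)]
    have e1' : (h.choose k * k.factorial * (h - k).factorial : ℝ) = h.factorial := by
      exact_mod_cast e1
    push_cast
    rw [← e1']
    ring
  rw [Finset.sum_congr rfl key, ← Finset.mul_sum, ← Nat.cast_sum, sum_choose_mul_choose]
  have e := Nat.choose_mul_factorial_mul_factorial (show h ≤ p + q + h + 1 by omega)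
  rw [show p + q + h + 1 - h = p + q + 1 by omega] at e
  rw [← e]
  push_cast
  ring

end Alpha

/-! ### α is an isometry and EPOSIC maps are covariant channels. -/

theorem irreducible_rho (m : ℕ) : (rho m).IsIrreducible := by
  have : Nontrivial (P m) := Module.nontrivial_of_finrank_pos (R := ℂ) (by rw [finrank_P]; omega)
  exact isIrreducible_of_invariant fun S hS => or_iff_not_imp_left.mpr (eq_top_of_invariant hS)

theorem adjoint_alpha_intertwines (r m n h : ℕ) :
    Representation.IsIntertwiningMap ((rho m).tprod (rho n)) (rho r) (alpha r m n h).adjoint :=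
  adjoint_intertwines (adjoint_rho r) (adjoint_tprod (adjoint_rho m) (adjoint_rho n))
    (alpha_intertwines r m n h)

theorem inner_smul_sum_tmul {E F ι : Type*} [NormedAddCommGroup E] [InnerProductSpace ℂ E]
    [NormedAddCommGroup F] [InnerProductSpace ℂ F] (s : Finset ι) (c : ℂ) (d : ι → ℂ) (e : ι → E)
    (f : ι → F) :
    inner ℂ (c • ∑ k ∈ s, d k • (e k ⊗ₜ[ℂ] f k)) (c • ∑ k ∈ s, d k • (e k ⊗ₜ[ℂ] f k)) =
      star c * c * ∑ k ∈ s, ∑ j ∈ s,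
        star (d k) * d j * (inner ℂ (e k) (e j) * inner ℂ (f k) (f j)) := by
  have hl : ∀ (a : ℂ) (x y : E ⊗[ℂ] F), inner ℂ (a • x) y = star a * inner ℂ x y :=
    fun a x y => inner_smul_left x y a
  have hr : ∀ (a : ℂ) (x y : E ⊗[ℂ] F), inner ℂ x (a • y) = a * inner ℂ x y :=
    fun a x y => inner_smul_right x y a
  rw [hl, hr, mul_assoc, sum_inner]
  simp only [inner_sum, hl, hr, TensorProduct.inner_tmul, mul_assoc, Finset.mul_sum]

theorem inner_alpha_highestWeight (p q h : ℕ) :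
    inner ℂ (alpha (p + q) (p + h) (q + h) h (mono (p + q) (p + q)))
      (alpha (p + q) (p + h) (q + h) h (mono (p + q) (p + q))) = ((p + q).factorial : ℂ) := by
  have hsum : inner ℂ (alpha (p + q) (p + h) (q + h) h (mono (p + q) (p + q)))
      (alpha (p + q) (p + h) (q + h) h (mono (p + q) (p + q))) =
      ((cgCoeff (p + h) (q + h) h * ((p + q).descFactorial q ^ 2 *
        ∑ k ∈ Finset.range (h + 1), (h.choose k : ℝ) ^ 2 *
          ((p + h - k).factorial * k.factorial * ((q + k).factorial * (h - k).factorial))) : ℝ) :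
            ℂ) := by
    have hc : 0 ≤ cgCoeff (p + h) (q + h) h := by
      rw [cgCoeff_eq]
      positivity
    rw [alpha_highestWeight]
    refine (inner_smul_sum_tmul _ _ _ _ _).trans ?_
    rw [Complex.star_def, Complex.conj_ofReal, ← Complex.ofReal_mul, Real.mul_self_sqrt hc,
      Complex.ofReal_mul]
    congr 1
    push_cast
    rw [Finset.mul_sum]
    refine Finset.sum_congr rfl fun k hk => ?_
    have hk := Nat.lt_succ_iff.mp (Finset.mem_range.mp hk)
    -- Different indices give orthogonal monomials in the second tensor factor, so only the diagonal
    -- survives.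
    rw [Finset.sum_eq_single k]
    · rw [inner_mono (by omega) (by omega), inner_mono (by omega) (by omega), if_pos rfl, if_pos rfl,
        show p + h - (p + h - k) = k by omega, show q + h - (q + k) = h - k by omega]
      have h1 : ((-1 : ℂ) ^ k) * (-1) ^ k = 1 := by
        rw [← mul_pow]
        simp
      simp only [map_mul, map_pow, map_neg, map_one, map_natCast]
      push_cast
      linear_combination (((p + q).descFactorial q : ℂ) ^ 2 * (h.choose k) ^ 2 *
        ((p + h - k).factorial * k.factorial * ((q + k).factorial * (h - k).factorial))) * h1
    · intro j hj hjk
      have hj := Nat.lt_succ_iff.mp (Finset.mem_range.mp hj)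
      rw [inner_mono (m := q + h) (by omega) (by omega), if_neg (by omega), mul_zero, mul_zero]
    · simp; omega
  rw [hsum, ← Complex.ofReal_natCast]
  congr 1
  have e1 := norm_alpha_sum p q h
  have e2 : ((p.factorial * (p + q).descFactorial q : ℕ) : ℝ) = (p + q).factorial := by
    have := Nat.factorial_mul_descFactorial (show q ≤ p + q by omega)
    rw [Nat.add_sub_cancel] at this
    exact_mod_cast this
  push_cast at e2
  have e3 : ((p + q).descFactorial q : ℝ) = (p + q).factorial / p.factorial := by
    rw [eq_div_iff (by positivity), mul_comm, e2]
  have e4 : ∑ k ∈ Finset.range (h + 1), (h.choose k : ℝ) ^ 2 *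
      ((p + h - k).factorial * k.factorial * ((q + k).factorial * (h - k).factorial)) =
      h.factorial * p.factorial * q.factorial * (p + q + h + 1).factorial /
        (p + q + 1).factorial := by
    rw [eq_div_iff (by positivity), e1]
  rw [cgCoeff_eq, e3, e4, Nat.factorial_succ (p + q)]
  push_cast
  field_simp

/-- By Schur α*α is a scalar, and the norm of the image of x₁^(p+q) shows that it is 1. -/
theorem adjoint_alpha_comp_alpha (p q h : ℕ) :
    (alpha (p + q) (p + h) (q + h) h).adjoint ∘ₗ alpha (p + q) (p + h) (q + h) h =
      LinearMap.id := by
  obtain ⟨c, hc⟩ := intertwining_eq_smul_id (irreducible_rho (p + q))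
    (f := (alpha (p + q) (p + h) (q + h) h).adjoint ∘ₗ alpha (p + q) (p + h) (q + h) h)
    ⟨fun g f => by
      rw [LinearMap.comp_apply, LinearMap.comp_apply, (alpha_intertwines _ _ _ _).isIntertwining,
        (adjoint_alpha_intertwines _ _ _ _).isIntertwining]⟩
  have h1 := inner_alpha_highestWeight p q h
  rw [← LinearMap.adjoint_inner_right, ← LinearMap.comp_apply, hc, LinearMap.smul_apply,
    LinearMap.id_apply, inner_smul_right, inner_mono le_rfl le_rfl, if_pos rfl, Nat.sub_self,
    Nat.factorial_zero, mul_one] at h1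
  have h2 : c = 1 := by
    have h0 : ((p + q).factorial : ℂ) ≠ 0 := Nat.cast_ne_zero.mpr (Nat.factorial_ne_zero _)
    exact mul_right_cancel₀ h0 (h1.trans (one_mul _).symm)
  rw [hc, h2, one_smul]

theorem adjoint_alpha_comp_alpha_of_le {r m n h : ℕ} (hr : r + 2 * h = m + n) (hh : h ≤ min m n) :
    (alpha r m n h).adjoint ∘ₗ alpha r m n h = LinearMap.id := by
  obtain ⟨p, rfl⟩ : ∃ p, m = p + h := ⟨m - h, by omega⟩
  obtain ⟨q, rfl⟩ : ∃ q, n = q + h := ⟨n - h, by omega⟩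
  obtain rfl : r = p + q := by omega
  exact adjoint_alpha_comp_alpha p q h

theorem isEquivariant_eposic (r m n h : ℕ) : IsEquivariant (rho r) (rho m) (eposic r m n h) :=
  isEquivariant_stinespring (alpha_intertwines r m n h) (adjoint_alpha_intertwines r m n h)

theorem isQuantumChannel_eposic {r m n h : ℕ} (hr : r + 2 * h = m + n) (hh : h ≤ min m n) :
    IsQuantumChannel (eposic r m n h) where
  completelyPositive := isCompletelyPositive_stinespring _
  trace_preserving := trace_stinespring (adjoint_alpha_comp_alpha_of_le hr hh)

/-! ### Decomposition of Hom(P_r, P_m) and the weights of a covariant channel. -/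

theorem sum_finrank_eq (r m : ℕ) :
    ∑ j ∈ Finset.range (min r m + 1), ((r - j) + (m - j) + 1) = (r + 1) * (m + 1) := by
  -- An (r + 1) × (m + 1) rectangle is peeled hook by hook: the j-th hook has (r - j) + (m - j) + 1
  -- cells, and at k = min r m + 1 one side of the remaining rectangle is zero.
  have h : ∀ k, k ≤ min r m + 1 →
      ∑ j ∈ Finset.range k, ((r - j) + (m - j) + 1) + (r + 1 - k) * (m + 1 - k) =
        (r + 1) * (m + 1) := by
    intro k
    induction k with
    | zero => simp
    | succ k ih =>
      intro hk
      rw [← ih (by omega), Finset.sum_range_succ]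
      obtain ⟨a, rfl⟩ : ∃ a, r = a + k := ⟨r - k, by omega⟩
      obtain ⟨b, rfl⟩ : ∃ b, m = b + k := ⟨m - k, by omega⟩
      rw [show a + k + 1 - (k + 1) = a by omega, show b + k + 1 - (k + 1) = b by omega,
        show a + k + 1 - k = a + 1 by omega, show b + k + 1 - k = b + 1 by omega]
      simp only [Nat.add_sub_cancel]
      ring
  have h0 : (r + 1 - (min r m + 1)) * (m + 1 - (min r m + 1)) = 0 := by
    rw [Nat.mul_eq_zero]
    omega
  have h1 := h _ le_rfl
  rwa [h0, add_zero] at h1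

/-- The EPOSIC channels `End(P r) → End(P m)`, indexed by `j = m - h`. -/
def indexedEposic (r m : ℕ) (j : Fin (min r m + 1)) :
    Module.End ℂ (P r) →ₗ[ℂ] Module.End ℂ (P m) :=
  eposic r m ((r - j) + (m - j)) (m - j)

theorem indexedEposic_mem_EC (r m : ℕ) (j : Fin (min r m + 1)) : indexedEposic r m j ∈ EC r m :=
  ⟨_, _, by have := j.2; omega, by have := j.2; omega, rfl⟩

/-- The Kraus operators of `indexedEposic r m j`. -/
def indexedKraus (r m : ℕ) (j : Fin (min r m + 1)) :
    Module.Dual ℂ (P ((r - j) + (m - j))) →ₗ[ℂ] (P r →ₗ[ℂ] P m) :=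
  kraus (alpha r m ((r - j) + (m - j)) (m - j))

/-- The trace pairing with the adjoints of the Kraus operators of `indexedEposic r m j`. -/
def indexedPairing (r m : ℕ) (j : Fin (min r m + 1)) :
    (P r →ₗ[ℂ] P m) →ₗ[ℂ] Module.Dual ℂ (P ((r - j) + (m - j))) :=
  tracePairing (alpha r m ((r - j) + (m - j)) (m - j)).adjoint

theorem indexedKraus_intertwines (r m : ℕ) (j : Fin (min r m + 1)) :
    Representation.IsIntertwiningMap (rho ((r - j) + (m - j))).dual ((rho r).linHom (rho m))
      (indexedKraus r m j) :=
  kraus_intertwines (alpha_intertwines _ _ _ _)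

theorem indexedPairing_intertwines (r m : ℕ) (j : Fin (min r m + 1)) :
    Representation.IsIntertwiningMap ((rho r).linHom (rho m)) (rho ((r - j) + (m - j))).dual
      (indexedPairing r m j) :=
  tracePairing_intertwines (adjoint_alpha_intertwines _ _ _ _)

theorem indexedPairing_comp_indexedKraus_ne_zero (r m : ℕ) (j : Fin (min r m + 1)) :
    indexedPairing r m j ∘ₗ indexedKraus r m j ≠ 0 :=
  have : Nontrivial (P r) := nontrivial_of_isIrreducible (irreducible_rho r)
  tracePairing_comp_kraus_ne_zero (adjoint_alpha_comp_alpha_of_le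
    (by have := j.2; omega) (by have := j.2; omega))

theorem choi_indexedEposic (r m : ℕ) (j : Fin (min r m + 1)) :
    choi (indexedEposic r m j) = indexedKraus r m j ∘ₗ indexedPairing r m j :=
  choi_stinespring _

/-- The dimensions r + m - 2j + 1 are distinct and add up to dim Hom(P_r, P_m), so the Choi operator
of Φ is a combination of those of the EPOSIC channels; injectivity of `choi` carries this back to Φ.
-/
theorem isEquivariant_eq_sum {r m : ℕ} {Φ : Module.End ℂ (P r) →ₗ[ℂ] Module.End ℂ (P m)}
    (hΦ : IsEquivariant (rho r) (rho m) Φ) :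
    ∃ l : Fin (min r m + 1) → ℂ, Φ = ∑ j, l j • indexedEposic r m j := by
  have hfr : ∀ j : Fin (min r m + 1), Module.finrank ℂ (Module.Dual ℂ (P ((r - j) + (m - j)))) =
      (r - j) + (m - j) + 1 := fun j => by rw [Subspace.dual_finrank_eq, finrank_P]
  obtain ⟨l, hl⟩ := intertwining_eq_sum_of_multiplicityFree
    (fun j => isIrreducible_dual (irreducible_rho _))
    (fun i j hij => by
      simp only [hfr] at hij
      have := i.2
      have := j.2
      exact Fin.ext (by omega))
    (by
      simp only [hfr]
      rw [Finset.sum_range (fun j => (r - j) + (m - j) + 1) |>.symm.trans (sum_finrank_eq r m),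
        Module.finrank_linearMap, finrank_P, finrank_P])
    (indexedKraus_intertwines r m) (indexedPairing_intertwines r m)
    (indexedPairing_comp_indexedKraus_ne_zero r m) (choi_intertwines hΦ)
  refine ⟨l, choi_injective ?_⟩
  rw [hl, map_sum]
  exact Finset.sum_congr rfl fun j _ => by rw [map_smul, choi_indexedEposic]

/-- The quadratic form of the Choi operator is tested on a Kraus operator of the j-th channel. By
Schur the other channels contribute zero, leaving l j times the value for the j-th channel alone. -/
theorem weight_nonneg_of_isCompletelyPositive {r m : ℕ} {l : Fin (min r m + 1) → ℂ}
    (h : IsCompletelyPositive (∑ j, l j • indexedEposic r m j)) (j : Fin (min r m + 1)) :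
    0 ≤ l j := by
  have hQκ : ∀ i, i ≠ j → ∀ ψ, indexedPairing r m j (indexedKraus r m i ψ) = 0 := fun i hij ψ => by
    have h0 := intertwining_eq_zero (isIrreducible_dual (irreducible_rho _))
      (isIrreducible_dual (irreducible_rho _))
      (by
        rw [Subspace.dual_finrank_eq, finrank_P, Subspace.dual_finrank_eq, finrank_P]
        have := i.2
        have := j.2
        have := Fin.val_ne_of_ne hij
        omega)
      (f := indexedPairing r m j ∘ₗ indexedKraus r m i) ⟨fun g v => by
        rw [LinearMap.comp_apply, LinearMap.comp_apply, (indexedKraus_intertwines r m i).isIntertwining,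
          (indexedPairing_intertwines r m j).isIntertwining]⟩
    exact congrArg (fun f => f ψ) h0
  obtain ⟨μ, hμ⟩ := intertwining_eq_smul_id (isIrreducible_dual (irreducible_rho _))
    (f := indexedPairing r m j ∘ₗ indexedKraus r m j) ⟨fun g v => by
        rw [LinearMap.comp_apply, LinearMap.comp_apply, (indexedKraus_intertwines r m j).isIntertwining,
          (indexedPairing_intertwines r m j).isIntertwining]⟩
  have hμ0 : μ ≠ 0 := fun h0 => indexedPairing_comp_indexedKraus_ne_zero r m j (by
    rw [hμ, h0, zero_smul])
  have hμ' : ∀ ψ, indexedPairing r m j (indexedKraus r m j ψ) = μ • ψ := fun ψ =>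
    congrArg (fun f => f ψ) hμ
  have : Nontrivial (P ((r - j) + (m - j))) := nontrivial_of_isIrreducible (irreducible_rho _)
  obtain ⟨w, hw⟩ := exists_ne (0 : P ((r - j) + (m - j)))
  let ψ : Module.Dual ℂ (P ((r - j) + (m - j))) := (innerSL ℂ w).toLinearMap
  have hψ : ψ w ≠ 0 := inner_self_ne_zero.mpr hw
  have hself : indexedPairing r m j (choi (indexedEposic r m j) (indexedKraus r m j ψ)) w =
      μ * (μ * ψ w) := by
    rw [choi_indexedEposic, LinearMap.comp_apply, hμ', hμ']
    rfl
  have hother : ∀ i, i ≠ j →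
      indexedPairing r m j (choi (indexedEposic r m i) (indexedKraus r m j ψ)) w = 0 :=
    fun i hij => by
      rw [choi_indexedEposic, LinearMap.comp_apply, hQκ i hij, LinearMap.zero_apply]
  -- The sign of this number is taken from complete positivity of the j-th channel itself, so μ need
  -- not be computed.
  have h1 : 0 ≤ μ * (μ * ψ w) := hself ▸ tracePairing_choi_kraus_nonneg
    (isCompletelyPositive_stinespring _) (alpha r m ((r - j) + (m - j)) (m - j)) w
  have h2 : 0 ≤ indexedPairing r m j
      (choi (∑ i, l i • indexedEposic r m i) (indexedKraus r m j ψ)) w :=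
    tracePairing_choi_kraus_nonneg h (alpha r m ((r - j) + (m - j)) (m - j)) w
  simp only [map_sum, map_smul, LinearMap.sum_apply, LinearMap.smul_apply] at h2
  rw [Finset.sum_eq_single j (fun i _ hij => by rw [hother i hij, smul_zero]) (by simp), hself,
    smul_eq_mul] at h2
  have h3 : 0 < μ * (μ * ψ w) :=
    lt_of_le_of_ne h1 (mul_ne_zero hμ0 (mul_ne_zero hμ0 hψ)).symm
  exact le_of_mul_le_mul_right (by rwa [zero_mul]) h3

/-- Compare traces at the identity of P_r, whose trace r + 1 is nonzero. -/
theorem sum_weight_eq_one_of_trace {r m : ℕ} {l : Fin (min r m + 1) → ℂ}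
    (h : ∀ A, LinearMap.trace ℂ (P m) ((∑ j, l j • indexedEposic r m j) A) =
      LinearMap.trace ℂ (P r) A) : ∑ j, l j = 1 := by
  have h1 := h LinearMap.id
  have h2 : ∀ j, LinearMap.trace ℂ (P m) (indexedEposic r m j LinearMap.id) =
      LinearMap.trace ℂ (P r) LinearMap.id := fun j =>
    (isQuantumChannel_eposic (by have := j.2; omega)
      (by have := j.2; omega)).trace_preserving _
  simp only [LinearMap.sum_apply, LinearMap.smul_apply, map_sum, map_smul, h2, smul_eq_mul,
    ← Finset.sum_mul] at h1
  rw [← Module.End.one_eq_id, LinearMap.trace_one, finrank_P] at h1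
  exact mul_right_cancel₀ (Nat.cast_ne_zero.mpr (Nat.succ_ne_zero r)) (h1.trans (one_mul _).symm)

theorem isEquivariant_smul_add {G H K : Type*} [Group G] [AddCommGroup H] [Module ℂ H]
    [AddCommGroup K] [Module ℂ K] {π : Representation ℂ G H} {σ : Representation ℂ G K}
    {Φ Ψ : Module.End ℂ H →ₗ[ℂ] Module.End ℂ K} (hΦ : IsEquivariant π σ Φ)
    (hΨ : IsEquivariant π σ Ψ) (a b : ℂ) : IsEquivariant π σ (a • Φ + b • Ψ) :=
  ⟨fun g A => by
    simp only [LinearMap.add_apply, LinearMap.smul_apply, hΦ.isIntertwining, hΨ.isIntertwining,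
      map_add, map_smul]⟩

theorem convex_isIrreduciblyCovariantChannel (r m : ℕ) :
    Convex ℝ {Φ : Module.End ℂ (P r) →ₗ[ℂ] Module.End ℂ (P m) |
      IsIrreduciblyCovariantChannel (rho r) (rho m) Φ} := by
  intro Φ hΦ Ψ hΨ a b ha hb hab
  refine ⟨irreducible_rho r, irreducible_rho m, ⟨?_, fun A => ?_⟩, ?_⟩
  · exact (hΦ.isQuantumChannel.completelyPositive.smul ha).add
      (hΨ.isQuantumChannel.completelyPositive.smul hb)
  · have h : LinearMap.trace ℂ (P m) ((a • Φ + b • Ψ) A) =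
        (a : ℂ) * LinearMap.trace ℂ (P m) (Φ A) + b * LinearMap.trace ℂ (P m) (Ψ A) := by
      have h1 : (a • Φ + b • Ψ) A = (a : ℂ) • Φ A + (b : ℂ) • Ψ A := rfl
      rw [h1, map_add, map_smul, map_smul, smul_eq_mul, smul_eq_mul]
    rw [h, hΦ.isQuantumChannel.trace_preserving, hΨ.isQuantumChannel.trace_preserving, ← add_mul,
      ← Complex.ofReal_add, hab, Complex.ofReal_one, one_mul]
  · exact isEquivariant_smul_add hΦ.isEquivariant hΨ.isEquivariant a b

end SU2Channel

end

theorem corollary3p17 (r m : ℕ) :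
    {Φ : Module.End ℂ (SU2Channel.P r) →ₗ[ℂ] Module.End ℂ (SU2Channel.P m) |
        SU2Channel.IsIrreduciblyCovariantChannel (SU2Channel.rho r) (SU2Channel.rho m) Φ} =
      convexHull ℝ (SU2Channel.EC r m) ∧
    (Submodule.span ℂ (SU2Channel.EC r m) :
        Set (Module.End ℂ (SU2Channel.P r) →ₗ[ℂ] Module.End ℂ (SU2Channel.P m))) =
      {Φ | SU2Channel.IsEquivariant (SU2Channel.rho r) (SU2Channel.rho m) Φ} := by
  open SU2Channel in
  refine ⟨Set.Subset.antisymm ?_ ?_, Set.Subset.antisymm ?_ ?_⟩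
  · intro Φ hΦ
    obtain ⟨l, rfl⟩ := isEquivariant_eq_sum hΦ.isEquivariant
    have hpos := weight_nonneg_of_isCompletelyPositive hΦ.isQuantumChannel.completelyPositive
    -- Nonnegativity in the order of ℂ includes being real, which makes the complex combination a
    -- convex one over ℝ.
    have hre : ∀ j, l j = ((l j).re : ℂ) := fun j =>
      Complex.ext rfl (Complex.nonneg_iff.mp (hpos j)).2.symm
    have hsum : ∑ j, (l j).re = 1 := by
      have h := sum_weight_eq_one_of_trace hΦ.isQuantumChannel.trace_preserving
      simpa using congrArg Complex.re h
    have h : ∑ j, l j • indexedEposic r m j = ∑ j, (l j).re • indexedEposic r m j :=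
      Finset.sum_congr rfl fun j _ => by
        conv_lhs => rw [hre j]
        rfl
    rw [h]
    exact (convex_convexHull ℝ _).sum_mem (fun j _ => (Complex.nonneg_iff.mp (hpos j)).1) hsum
      fun j _ => subset_convexHull ℝ _ (indexedEposic_mem_EC r m j)
  · refine convexHull_min ?_ (convex_isIrreduciblyCovariantChannel r m)
    rintro Φ ⟨n, h, hr, hh, rfl⟩
    exact ⟨irreducible_rho r, irreducible_rho m, isQuantumChannel_eposic hr hh,
      isEquivariant_eposic r m n h⟩
  · intro Φ hΦ
    induction hΦ using Submodule.span_induction with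
    | mem Φ h =>
      obtain ⟨n, h, _, _, rfl⟩ := h
      exact isEquivariant_eposic r m n h
    | zero => exact ⟨fun g A => by simp⟩
    | add Φ Ψ _ _ hΦ hΨ => simpa using isEquivariant_smul_add hΦ hΨ 1 1
    | smul c Φ _ hΦ => simpa using isEquivariant_smul_add hΦ hΦ c 0
  · intro Φ hΦ
    obtain ⟨l, rfl⟩ := isEquivariant_eq_sum hΦ
    exact Submodule.sum_mem _ fun j _ =>
      Submodule.smul_mem _ _ (Submodule.subset_span (indexedEposic_mem_EC r m j))
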